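/- Let $M$ be a closed smooth 3-manifold with $H_*(M;\mathbb{Q})\cong H_*(S^3;\mathbb{Q})$ (a rational homology 3-sphere), with a fixed orientation. A framing of $M$ is a triple $(X_1,X_2,X_3)$ of continuous vector fields that forms a positively oriented basis of the tangent space at each point, and two framings are homotopic if they are joined by a continuous path of framings. A tangent plane field is a continuous rank-two subbundle $\xi\subset TM$, and two plane fields are homotopic if they are joined by a continuous path of tangent plane fields. An orientation makes an orientable plane field $\xi$ a complex line bundle, whose first Chern class $c_1(\xi)\in H^2(M;\mathbb{Z})$ is well defined up to sign as the orientation varies, so that the condition $c_1(\xi)=0$ does not depend on the orientation of $\xi$. Then for every framing $(X_1,X_2,X_3)$ the plane field $\operatorname{span}(X_1,X_2)$ is orientable with $c_1=0$, and $$[(X_1,X_2,X_3)]\longmapsto[\operatorname{span}(X_1,X_2)]$$ is a well-defined bijection from the set of homotopy classes of framings of $M$ onto the set of homotopy classes of orientable tangent plane fields $\xi$ on $M$ with $c_1(\xi)=0$. -/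

import Mathlib

open Set Filter Topology Module
open scoped Manifold ContDiff

universe u

/-! ### Rational homology spheres -/

/-- The `k`-th singular homology group of the space `M` with rational coefficients. -/
noncomputable def rationalHomology (M : Type u) [TopologicalSpace M] (k : ℕ) : ModuleCat.{u} ℚ :=
  ((AlgebraicTopology.singularHomologyFunctor (ModuleCat.{u} ℚ) k).obj
    (ModuleCat.of ℚ (ULift.{u} ℚ))).obj (TopCat.of M)

/-- `M` has the rational homology of the 3-sphere: `H_k(M; ℚ)` is `ℚ` for `k = 0, 3` and vanishes
in all other degrees. -/
def HasRationalHomologyOfThreeSphere (M : Type u) [TopologicalSpace M] : Prop :=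
  ∀ k : ℕ, ((k = 0 ∨ k = 3) → Nonempty (rationalHomology M k ≃ₗ[ℚ] ℚ)) ∧
    ((k ≠ 0 ∧ k ≠ 3) → Subsingleton (rationalHomology M k))

/-! ### The second Čech cohomology group with integer coefficients

Čech cohomology is the direct limit over all open covers. The covers `U = (U a)_{a ∈ M}` by open
neighbourhoods `U a` of the points `a` of `M`, ordered by `∀ a, V a ⊆ U a`, are directed, and every
open cover is refined by one of them; so the limit may be taken over them, with the identity of the
index set as refinement map. A 2-cochain `n` assigns to `a b c : M` an integer-valued function
`n a b c`, of which only the values on `U a ∩ U b ∩ U c` matter, where it has to be continuous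
(that is, locally constant). In the limit two cochains are the same as soon as they agree over some
cover, so that the limit of the quotients `Z²(U) / B²(U)` is the quotient of the group of functions
that are cocycles over some cover by those that are coboundaries over some cover. -/

/-- An open cover of `M`, consisting of an open neighbourhood of each point. -/
structure PointedCover (M : Type u) [TopologicalSpace M] where
  nbhd : M → Set M
  isOpen : ∀ a, IsOpen (nbhd a)
  mem : ∀ a, a ∈ nbhd a

/-- The common refinement of two covers. -/
def PointedCover.inf {M : Type u} [TopologicalSpace M] (U V : PointedCover M) :
    PointedCover M where
  nbhd a := U.nbhd a ∩ V.nbhd a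
  isOpen a := (U.isOpen a).inter (V.isOpen a)
  mem a := ⟨U.mem a, V.mem a⟩

/-- `n` is an integral Čech 2-cocycle over the cover `U`. -/
def IsCechCocycle {M : Type u} [TopologicalSpace M] (U : PointedCover M)
    (n : M → M → M → M → ℤ) : Prop :=
  (∀ a b c, ContinuousOn (n a b c) (U.nbhd a ∩ U.nbhd b ∩ U.nbhd c)) ∧
  ∀ a b c d, ∀ x ∈ U.nbhd a ∩ U.nbhd b ∩ U.nbhd c ∩ U.nbhd d,
    n b c d x - n a c d x + n a b d x - n a b c x = 0

/-- `n` is, over the cover `U`, the coboundary of an integral Čech 1-cochain. -/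
def IsCechCoboundary {M : Type u} [TopologicalSpace M] (U : PointedCover M)
    (n : M → M → M → M → ℤ) : Prop :=
  ∃ m : M → M → M → ℤ, (∀ a b, ContinuousOn (m a b) (U.nbhd a ∩ U.nbhd b)) ∧
    ∀ a b c, ∀ x ∈ U.nbhd a ∩ U.nbhd b ∩ U.nbhd c, n a b c x = m b c x - m a c x + m a b x

/-- The group of integral 2-cochains that are cocycles over some cover. -/
def cechCocycles (M : Type u) [TopologicalSpace M] : AddSubgroup (M → M → M → M → ℤ) where
  carrier := {n | ∃ U : PointedCover M, IsCechCocycle U n}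
  zero_mem' := ⟨⟨fun _ => univ, fun _ => isOpen_univ, fun _ => mem_univ _⟩,
    fun _ _ _ => continuousOn_const, fun _ _ _ _ _ _ => by simp⟩
  add_mem' := by
    rintro n n' ⟨U, hU, hU'⟩ ⟨V, hV, hV'⟩
    refine ⟨U.inf V, fun a b c => ?_, fun a b c d x hx => ?_⟩
    · exact ((hU a b c).mono fun x hx => ⟨⟨hx.1.1.1, hx.1.2.1⟩, hx.2.1⟩).add
        ((hV a b c).mono fun x hx => ⟨⟨hx.1.1.2, hx.1.2.2⟩, hx.2.2⟩)
    · have h1 := hU' a b c d x ⟨⟨⟨hx.1.1.1.1, hx.1.1.2.1⟩, hx.1.2.1⟩, hx.2.1⟩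
      have h2 := hV' a b c d x ⟨⟨⟨hx.1.1.1.2, hx.1.1.2.2⟩, hx.1.2.2⟩, hx.2.2⟩
      simp only [Pi.add_apply]
      linarith
  neg_mem' := by
    rintro n ⟨U, hU, hU'⟩
    refine ⟨U, fun a b c => (hU a b c).neg, fun a b c d x hx => ?_⟩
    have h1 := hU' a b c d x hx
    simp only [Pi.neg_apply]
    linarith

/-- The group of integral 2-cochains that are coboundaries over some cover. -/
def cechCoboundaries (M : Type u) [TopologicalSpace M] : AddSubgroup (M → M → M → M → ℤ) where
  carrier := {n | ∃ U : PointedCover M, IsCechCoboundary U n}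
  zero_mem' := ⟨⟨fun _ => univ, fun _ => isOpen_univ, fun _ => mem_univ _⟩,
    fun _ _ _ => 0, fun _ _ => continuousOn_const, fun _ _ _ _ _ => by simp⟩
  add_mem' := by
    rintro n n' ⟨U, m, hm, hU⟩ ⟨V, m', hm', hV⟩
    refine ⟨U.inf V, m + m', fun a b => ?_, fun a b c x hx => ?_⟩
    · exact ((hm a b).mono fun x hx => ⟨hx.1.1, hx.2.1⟩).add
        ((hm' a b).mono fun x hx => ⟨hx.1.2, hx.2.2⟩)
    · have h1 := hU a b c x ⟨⟨hx.1.1.1, hx.1.2.1⟩, hx.2.1⟩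
      have h2 := hV a b c x ⟨⟨hx.1.1.2, hx.1.2.2⟩, hx.2.2⟩
      simp only [Pi.add_apply]
      linarith
  neg_mem' := by
    rintro n ⟨U, m, hm, hU⟩
    refine ⟨U, -m, fun a b => (hm a b).neg, fun a b c x hx => ?_⟩
    have h1 := hU a b c x hx
    simp only [Pi.neg_apply]
    linarith

/-- The second Čech cohomology group `H²(M; ℤ)`. -/
abbrev CechH2 (M : Type u) [TopologicalSpace M] : Type u :=
  cechCocycles M ⧸ (cechCoboundaries M).addSubgroupOf (cechCocycles M)

/-! ### Frames and orientations -/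

/-- `v` is a basis of `V`, positive for the orientation `o`. -/
def IsPositiveFrame {ι V : Type*} [Fintype ι] [DecidableEq ι] [AddCommGroup V] [Module ℝ V]
    (o : Orientation ℝ V ι) (v : ι → V) : Prop :=
  ∃ b : Basis ι ℝ V, ⇑b = v ∧ b.orientation = o

section Manifold

variable {M : Type u} [TopologicalSpace M] [ChartedSpace (EuclideanSpace ℝ (Fin 3)) M]
  [IsManifold (𝓡 3) ∞ M]

/-- `v` is, on the set `s`, a continuous tangent vector field along the map `f : B → M`. -/
def ContinuousFieldOn {B : Type*} [TopologicalSpace B] (f : B → M)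
    (v : ∀ b, TangentSpace (𝓡 3) (f b)) (s : Set B) : Prop :=
  ContinuousOn (fun b => (⟨f b, v b⟩ : TangentBundle (𝓡 3) M)) s

variable (M) in
/-- An orientation of the 3-manifold `M`: an orientation of every tangent space, such that locally
there are continuous positive frames. -/
structure ManifoldOrientation where
  at_ : ∀ x : M, Orientation ℝ (TangentSpace (𝓡 3) x) (Fin 3)
  exists_frame : ∀ x₀ : M, ∃ U ∈ 𝓝 x₀, ∃ X : Fin 3 → ∀ x : M, TangentSpace (𝓡 3) x,
    (∀ i, ContinuousFieldOn id (X i) U) ∧ ∀ x ∈ U, IsPositiveFrame (at_ x) (fun i => X i x)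

/-! ### Framings and their homotopies -/

/-- `X` is a continuous family of positive frames of tangent spaces of `M` along `f : B → M`. -/
structure IsFramingAlong {B : Type*} [TopologicalSpace B] (o : ManifoldOrientation M) (f : B → M)
    (X : Fin 3 → ∀ b, TangentSpace (𝓡 3) (f b)) : Prop where
  continuous : ∀ i, ContinuousFieldOn f (X i) univ
  positive : ∀ b, IsPositiveFrame (o.at_ (f b)) (fun i => X i b)

/-- A framing of the oriented 3-manifold `M`: three continuous vector fields that form a positive
basis of the tangent space at every point. -/
structure Framing (o : ManifoldOrientation M) where
  field : Fin 3 → ∀ x : M, TangentSpace (𝓡 3) x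
  isFraming : IsFramingAlong o id field

/-- Two framings are homotopic if they are joined by a continuous path of framings. -/
def Framing.Homotopic {o : ManifoldOrientation M} (X Y : Framing o) : Prop :=
  ∃ Z : Fin 3 → ∀ p : unitInterval × M, TangentSpace (𝓡 3) p.2,
    IsFramingAlong o (fun p : unitInterval × M => p.2) Z ∧
    (∀ i x, Z i (0, x) = X.field i x) ∧ ∀ i x, Z i (1, x) = Y.field i x

/-! ### Tangent plane fields and their homotopies -/

/-- `ξ` is a continuous family of planes in tangent spaces of `M` along `f : B → M`: every `ξ b` has
dimension two, and locally `ξ` is spanned by two continuous vector fields. -/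
structure IsPlaneFieldAlong {B : Type*} [TopologicalSpace B] (f : B → M)
    (ξ : ∀ b, Submodule ℝ (TangentSpace (𝓡 3) (f b))) : Prop where
  finrank_eq : ∀ b, finrank ℝ (ξ b) = 2
  exists_frame : ∀ b₀, ∃ U ∈ 𝓝 b₀, ∃ X : Fin 2 → ∀ b, TangentSpace (𝓡 3) (f b),
    (∀ i, ContinuousFieldOn f (X i) U) ∧
    ∀ b ∈ U, ξ b = Submodule.span ℝ (range fun i => X i b)

variable (M) in
/-- A tangent plane field on `M`: a continuous rank two subbundle of the tangent bundle. -/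
structure PlaneField where
  plane : ∀ x : M, Submodule ℝ (TangentSpace (𝓡 3) x)
  isPlaneField : IsPlaneFieldAlong id plane

/-- Two plane fields are homotopic if they are joined by a continuous path of plane fields. -/
def PlaneField.Homotopic (ξ η : PlaneField M) : Prop :=
  ∃ ζ : ∀ p : unitInterval × M, Submodule ℝ (TangentSpace (𝓡 3) p.2),
    IsPlaneFieldAlong (fun p : unitInterval × M => p.2) ζ ∧
    (∀ x, ζ (0, x) = ξ.plane x) ∧ ∀ x, ζ (1, x) = η.plane x

/-- An orientation of the plane field `ξ`: an orientation of every plane, such that locally there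
are continuous positive frames. -/
structure PlaneField.PlaneOrientation (ξ : PlaneField M) where
  at_ : ∀ x : M, Orientation ℝ (ξ.plane x) (Fin 2)
  exists_frame : ∀ x₀ : M, ∃ U ∈ 𝓝 x₀, ∃ X : Fin 2 → ∀ x : M, ξ.plane x,
    (∀ i, ContinuousFieldOn id (fun x => (X i x : TangentSpace (𝓡 3) x)) U) ∧
    ∀ x ∈ U, IsPositiveFrame (at_ x) (fun i => X i x)

/-! ### The first Chern class

An oriented plane field becomes a complex line bundle by an atlas of local positive frames whose
transition matrices lie in `ℂ \ {0} = GL(1, ℂ) ⊆ GL⁺(2, ℝ)`. The transition functions `g a b` are a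
1-cocycle with values in the nonvanishing continuous complex functions, and the first Chern class is
its image under the connecting homomorphism of the exponential sequence `0 → ℤ → ℂ → ℂ \ {0} → 0`:
if `g a b = exp (2πi h a b)`, then the class is represented by the integral cocycle
`h b c - h a c + h a b`. It does not depend on the choices, and changes its sign with the
orientation. -/

/-- Local positive frames of an oriented plane field over an open cover, which differ on the
overlaps by the nonvanishing complex functions `exp (2πi h a b)`. -/
structure PlaneField.PlaneOrientation.ComplexAtlas {ξ : PlaneField M}
    (σ : ξ.PlaneOrientation) where
  cover : PointedCover M
  frame : M → Fin 2 → ∀ x : M, ξ.plane x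
  continuous_frame : ∀ a i,
    ContinuousFieldOn id (fun x => (frame a i x : TangentSpace (𝓡 3) x)) (cover.nbhd a)
  positive_frame : ∀ a, ∀ x ∈ cover.nbhd a, IsPositiveFrame (σ.at_ x) (fun i => frame a i x)
  logTransition : M → M → M → ℂ
  continuous_logTransition : ∀ a b,
    ContinuousOn (logTransition a b) (cover.nbhd a ∩ cover.nbhd b)
  transition : ∀ a b, ∀ x ∈ cover.nbhd a ∩ cover.nbhd b,
    ∀ g : ℂ, g = Complex.exp (2 * Real.pi * Complex.I * logTransition a b x) →
      frame b 0 x = g.re • frame a 0 x + g.im • frame a 1 x ∧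
      frame b 1 x = -g.im • frame a 0 x + g.re • frame a 1 x

/-- `c ∈ H²(M; ℤ)` is the first Chern class of the plane field `ξ` with the orientation `σ`. -/
def PlaneField.PlaneOrientation.HasFirstChernClass {ξ : PlaneField M}
    (σ : ξ.PlaneOrientation) (c : CechH2 M) : Prop :=
  ∃ (A : σ.ComplexAtlas) (n : cechCocycles M),
    (∀ a b c, ∀ x ∈ A.cover.nbhd a ∩ A.cover.nbhd b ∩ A.cover.nbhd c,
      ((n : M → M → M → M → ℤ) a b c x : ℂ) =
        A.logTransition b c x - A.logTransition a c x + A.logTransition a b x) ∧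
    c = QuotientAddGroup.mk n

/-- `ξ` is orientable and `c₁(ξ) = 0` for an orientation of `ξ`. -/
def PlaneField.IsOrientableWithZeroChernClass (ξ : PlaneField M) : Prop :=
  ∃ σ : ξ.PlaneOrientation, σ.HasFirstChernClass 0

/-! ### Homotopy is an equivalence relation -/

section Gluing

variable {B : Type*} [TopologicalSpace B] {f : B → M}

theorem ContinuousFieldOn.mono {v : ∀ b, TangentSpace (𝓡 3) (f b)} {s t : Set B}
    (h : ContinuousFieldOn f v s) (hts : t ⊆ s) : ContinuousFieldOn f v t :=
  ContinuousOn.mono h hts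

theorem continuousFieldOn_iff {v : ∀ b, TangentSpace (𝓡 3) (f b)} {s : Set B} (hf : Continuous f) :
    ContinuousFieldOn f v s ↔ ∀ b₀ ∈ s, ContinuousWithinAt (fun b =>
      (trivializationAt (EuclideanSpace ℝ (Fin 3)) (TangentSpace (𝓡 3)) (f b₀)).linearMapAt ℝ (f b)
        (v b)) s b₀ := by
  refine forall₂_congr fun b₀ hb₀ => ?_
  rw [FiberBundle.continuousWithinAt_totalSpace]
  have hev : ∀ᶠ b in 𝓝[s] b₀, f b ∈
      (trivializationAt (EuclideanSpace ℝ (Fin 3)) (TangentSpace (𝓡 3) (M := M))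
        (f b₀)).baseSet :=
    (hf.continuousAt.eventually ((trivializationAt (EuclideanSpace ℝ (Fin 3))
      (TangentSpace (𝓡 3) (M := M)) (f b₀)).open_baseSet.mem_nhds
      (FiberBundle.mem_baseSet_trivializationAt' (f b₀)))).filter_mono nhdsWithin_le_nhds
  rw [and_iff_right hf.continuousWithinAt]
  have : (fun b => (trivializationAt (EuclideanSpace ℝ (Fin 3)) (TangentSpace (𝓡 3) (M := M))
      (f b₀) (⟨f b, v b⟩ : TangentBundle (𝓡 3) M)).2) =ᶠ[𝓝[s] b₀] fun b =>
      (trivializationAt (EuclideanSpace ℝ (Fin 3)) (TangentSpace (𝓡 3)) (f b₀)).linearMapAt ℝ (f b)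
        (v b) := by
    filter_upwards [hev] with b hb
    rw [Bundle.Trivialization.coe_linearMapAt_of_mem _ hb]
  exact this.congr_continuousWithinAt (this.self_of_nhdsWithin hb₀)

theorem ContinuousFieldOn.sum_smul {κ : Type*} [Fintype κ]
    {v : κ → ∀ b, TangentSpace (𝓡 3) (f b)} {c : κ → B → ℝ} {s : Set B} (hf : Continuous f)
    (hv : ∀ j, ContinuousFieldOn f (v j) s) (hc : ∀ j, ContinuousOn (c j) s) :
    ContinuousFieldOn f (fun b => ∑ j, c j b • v j b) s := by
  rw [continuousFieldOn_iff hf]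
  intro b₀ hb₀
  simp only [map_sum, map_smul]
  exact tendsto_finsetSum _ fun j _ =>
    (hc j b₀ hb₀).smul ((continuousFieldOn_iff hf).1 (hv j) b₀ hb₀)

theorem ContinuousFieldOn.continuousOn_linearMapAt {v : ∀ b, TangentSpace (𝓡 3) (f b)} {s : Set B}
    (hv : ContinuousFieldOn f v s) (x₀ : M) :
    ContinuousOn (fun b =>
      (trivializationAt (EuclideanSpace ℝ (Fin 3)) (TangentSpace (𝓡 3)) x₀).linearMapAt ℝ (f b)
        (v b)) (s ∩ f ⁻¹' (trivializationAt (EuclideanSpace ℝ (Fin 3))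
          (TangentSpace (𝓡 3) (M := M)) x₀).baseSet) := by
  set e := trivializationAt (EuclideanSpace ℝ (Fin 3)) (TangentSpace (𝓡 3) (M := M)) x₀
  have h1 : ContinuousOn (fun b => (e (⟨f b, v b⟩ : TangentBundle (𝓡 3) M)).2)
      (s ∩ f ⁻¹' e.baseSet) :=
    continuous_snd.comp_continuousOn (e.continuousOn.comp (hv.mono inter_subset_left)
      fun b hb => e.mem_source.2 hb.2)
  refine h1.congr fun b hb => ?_
  rw [Bundle.Trivialization.coe_linearMapAt_of_mem _ hb.2]

theorem IsPlaneFieldAlong.exists_normalised_frame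
    {ξ : ∀ b, Submodule ℝ (TangentSpace (𝓡 3) (f b))} (hf : Continuous f)
    (h : IsPlaneFieldAlong f ξ) (b₀ : B) (L : EuclideanSpace ℝ (Fin 3) →L[ℝ] (Fin 2 → ℝ))
    (hL : ∀ v ∈ ξ b₀, L ((trivializationAt (EuclideanSpace ℝ (Fin 3)) (TangentSpace (𝓡 3))
      (f b₀)).linearMapAt ℝ (f b₀) v) = 0 → v = 0) :
    ∃ U ∈ 𝓝 b₀, ∃ X : Fin 2 → ∀ b, TangentSpace (𝓡 3) (f b),
      (∀ i, ContinuousFieldOn f (X i) U) ∧ ∀ b ∈ U,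
        ξ b = Submodule.span ℝ (range fun i => X i b) ∧
        ∀ i, L ((trivializationAt (EuclideanSpace ℝ (Fin 3)) (TangentSpace (𝓡 3))
          (f b₀)).linearMapAt ℝ (f b) (X i b)) = Pi.single i 1 := by
  set e := trivializationAt (EuclideanSpace ℝ (Fin 3)) (TangentSpace (𝓡 3) (M := M)) (f b₀)
  obtain ⟨U, hU, X, hX, hspan⟩ := h.exists_frame b₀
  let W := U ∩ f ⁻¹' e.baseSet
  have hW : W ∈ 𝓝 b₀ := inter_mem hU (hf.continuousAt.preimage_mem_nhds
    (e.open_baseSet.mem_nhds (FiberBundle.mem_baseSet_trivializationAt' (f b₀))))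
  let A : B → Matrix (Fin 2) (Fin 2) ℝ := fun b =>
    Matrix.of fun k j => L (e.linearMapAt ℝ (f b) (X j b)) k
  have hA : ContinuousOn A W := by
    refine continuousOn_pi.2 fun k => continuousOn_pi.2 fun j => ?_
    exact (continuous_apply k).comp_continuousOn
      (L.continuous.comp_continuousOn ((hX j).continuousOn_linearMapAt (f b₀)))
  have hdet : ContinuousOn (fun b => (A b).det) W := by
    rw [continuousOn_iff_continuous_domRestrict] at hA ⊢
    exact hA.matrix_det
  have hdet0 : (A b₀).det ≠ 0 := by
    have hli : LinearIndependent ℝ (fun j => X j b₀) := by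
      rw [linearIndependent_iff_card_eq_finrank_span]
      have := h.finrank_eq b₀
      rw [hspan b₀ (mem_of_mem_nhds hU)] at this
      simpa [Set.finrank] using this.symm
    have hcol : LinearIndependent ℝ (A b₀).col := by
      have : (A b₀).col = (L.toLinearMap ∘ₗ e.linearMapAt ℝ (f b₀)) ∘ (fun j => X j b₀) := rfl
      rw [this]
      refine hli.map ?_
      rw [← hspan b₀ (mem_of_mem_nhds hU), Submodule.disjoint_def]
      exact fun v hv hv' => hL v hv hv'
    have := Matrix.linearIndependent_cols_iff_isUnit.1 hcol
    exact ((Matrix.isUnit_iff_isUnit_det _).1 this).ne_zero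
  let U' := {b ∈ W | (A b).det ≠ 0}
  have hU' : U' ∈ 𝓝 b₀ :=
    inter_mem hW ((hdet.continuousAt hW).preimage_mem_nhds (isOpen_ne.mem_nhds hdet0))
  have hinv : ∀ j i, ContinuousOn (fun b => (A b)⁻¹ j i) U' := by
    intro j i
    have h1 : ContinuousOn (fun b => (A b).adjugate j i) U' := by
      have hA' := hA.mono (fun b hb => hb.1 : U' ⊆ W)
      rw [continuousOn_iff_continuous_domRestrict] at hA' ⊢
      exact (hA'.matrix_adjugate).matrix_elem j i
    have h2 : ContinuousOn (fun b => ((A b).det)⁻¹) U' :=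
      (hdet.mono fun b hb => hb.1).inv₀ fun b hb => hb.2
    refine (h2.mul h1).congr fun b _ => ?_
    simp [Matrix.inv_def]
  refine ⟨U', hU', fun i b => ∑ j, (A b)⁻¹ j i • X j b, fun i => ?_, fun b hb => ?_⟩
  · exact ContinuousFieldOn.sum_smul hf
      (fun j => (hX j).mono fun b hb => hb.1.1) fun j => hinv j i
  · have hnorm : ∀ i, L (e.linearMapAt ℝ (f b) (∑ j, (A b)⁻¹ j i • X j b)) = Pi.single i 1 := by
      intro i
      have hmul : A b * (A b)⁻¹ = 1 := Matrix.mul_nonsing_inv _ (isUnit_iff_ne_zero.2 hb.2)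
      ext k
      have := congrFun (congrFun hmul k) i
      rw [Matrix.mul_apply, Matrix.one_apply] at this
      simp only [map_sum, map_smul, Finset.sum_apply, Pi.smul_apply, smul_eq_mul, Pi.single_apply]
      rw [← this]
      exact Finset.sum_congr rfl fun j _ => mul_comm _ _
    refine ⟨?_, hnorm⟩
    have hle : Submodule.span ℝ (range fun i => ∑ j, (A b)⁻¹ j i • X j b) ≤ ξ b := by
      rw [Submodule.span_le]
      rintro _ ⟨i, rfl⟩
      rw [hspan b hb.1.1]
      exact Submodule.sum_mem _ fun j _ =>
        Submodule.smul_mem _ _ (Submodule.subset_span ⟨j, rfl⟩)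
    have hli : LinearIndependent ℝ (fun i => ∑ j, (A b)⁻¹ j i • X j b) := by
      refine LinearIndependent.of_comp (L.toLinearMap ∘ₗ e.linearMapAt ℝ (f b)) ?_
      have : (L.toLinearMap ∘ₗ e.linearMapAt ℝ (f b)) ∘ (fun i => ∑ j, (A b)⁻¹ j i • X j b) =
          fun i => Pi.single i 1 := funext hnorm
      rw [this]
      have := (Pi.basisFun ℝ (Fin 2)).linearIndependent
      convert this using 2
      simp
    have : FiniteDimensional ℝ (ξ b) := Module.finite_of_finrank_pos (by rw [h.finrank_eq b]; simp)
    refine (Submodule.eq_of_le_of_finrank_eq hle ?_).symm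
    rw [finrank_span_eq_card hli, h.finrank_eq b, Fintype.card_fin]

/-- Two plane fields along `f` that agree where `φ = 0` can be glued along this set. -/
theorem IsPlaneFieldAlong.glue {ξ η : ∀ b, Submodule ℝ (TangentSpace (𝓡 3) (f b))}
    (hf : Continuous f) (hξ : IsPlaneFieldAlong f ξ) (hη : IsPlaneFieldAlong f η) {φ : B → ℝ}
    (hφ : Continuous φ) (hag : ∀ b, φ b = 0 → ξ b = η b) :
    IsPlaneFieldAlong f (fun b => if φ b ≤ 0 then ξ b else η b) := by
  refine ⟨fun b => ?_, fun b₀ => ?_⟩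
  · by_cases hb : φ b ≤ 0
    · exact (congrArg (fun S : Submodule ℝ (TangentSpace (𝓡 3) (f b)) => finrank ℝ S)
        (if_pos hb)).trans (hξ.finrank_eq b)
    · exact (congrArg (fun S : Submodule ℝ (TangentSpace (𝓡 3) (f b)) => finrank ℝ S)
        (if_neg hb)).trans (hη.finrank_eq b)
  rcases lt_trichotomy (φ b₀) 0 with h | h | h
  · obtain ⟨U, hU, X, hX, hs⟩ := hξ.exists_frame b₀
    refine ⟨U ∩ φ ⁻¹' Iio 0, inter_mem hU (hφ.continuousAt.preimage_mem_nhds (Iio_mem_nhds h)), X,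
      fun i => (hX i).mono inter_subset_left, fun b hb => ?_⟩
    have : φ b ≤ 0 := le_of_lt hb.2
    rw [if_pos this, hs b hb.1]
  · set e := trivializationAt (EuclideanSpace ℝ (Fin 3)) (TangentSpace (𝓡 3) (M := M)) (f b₀)
    have he : f b₀ ∈ e.baseSet := FiberBundle.mem_baseSet_trivializationAt' (f b₀)
    have : FiniteDimensional ℝ (ξ b₀) :=
      Module.finite_of_finrank_pos (by rw [hξ.finrank_eq b₀]; simp)
    let E₀ : ξ b₀ ≃ₗ[ℝ] (Fin 2 → ℝ) :=
      LinearEquiv.ofFinrankEq _ _ (by rw [hξ.finrank_eq b₀]; simp)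
    obtain ⟨L₀, hL₀⟩ := E₀.toLinearMap.exists_extend
    let L : EuclideanSpace ℝ (Fin 3) →L[ℝ] (Fin 2 → ℝ) :=
      LinearMap.toContinuousLinearMap (L₀ ∘ₗ e.symmₗ ℝ (f b₀))
    have hL : ∀ v ∈ ξ b₀, L (e.linearMapAt ℝ (f b₀) v) = 0 → v = 0 := by
      intro v hv hv0
      have h1 : L (e.linearMapAt ℝ (f b₀) v) = L₀ v := by
        change L₀ (e.symmₗ ℝ (f b₀) (e.linearMapAt ℝ (f b₀) v)) = L₀ v
        rw [e.symmₗ_linearMapAt he]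
      have h2 : L₀ v = E₀ ⟨v, hv⟩ := LinearMap.congr_fun hL₀ ⟨v, hv⟩
      rw [h1, h2] at hv0
      have := E₀.map_eq_zero_iff.1 hv0
      exact congrArg Subtype.val this
    obtain ⟨U, hU, X, hX, hXs⟩ := hξ.exists_normalised_frame hf b₀ L hL
    obtain ⟨V, hV, Y, hY, hYs⟩ := hη.exists_normalised_frame hf b₀ L (by rwa [← hag b₀ h])
    have hXY : ∀ b ∈ U ∩ V, φ b = 0 → ∀ i, X i b = Y i b := by
      intro b hb hb0 i
      have hmem : X i b ∈ Submodule.span ℝ (range fun i => Y i b) := by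
        rw [← (hYs b hb.2).1, ← hag b hb0, (hXs b hb.1).1]
        exact Submodule.subset_span ⟨i, rfl⟩
      obtain ⟨c, hc⟩ := (Submodule.mem_span_range_iff_exists_fun ℝ).1 hmem
      have h1 := (hXs b hb.1).2 i
      rw [← hc] at h1
      simp only [map_sum, map_smul, (hYs b hb.2).2] at h1
      have hci : c = Pi.single i 1 := by
        rw [← h1]
        ext k
        simp [Finset.sum_apply, Pi.single_apply]
      rw [← hc, hci]
      simp [Pi.single_apply]
    refine ⟨U ∩ V, inter_mem hU hV, fun i b => if φ b ≤ 0 then X i b else Y i b, fun i => ?_,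
      fun b hb => ?_⟩
    · have hg : ContinuousOn (fun b => if φ b ≤ 0 then (⟨f b, X i b⟩ : TangentBundle (𝓡 3) M)
          else ⟨f b, Y i b⟩) (U ∩ V) := by
        refine ContinuousOn.if' ?_ ?_ ?_ ?_
        · intro b hb
          have h0 : φ b = 0 := frontier_le_subset_eq hφ continuous_const hb.2
          have hXb := (hX i).mono (inter_subset_left (t := V)) b hb.1
          rw [if_pos h0.le]
          exact hXb.mono_left (nhdsWithin_mono _ inter_subset_left)
        · intro b hb
          have h0 : φ b = 0 := frontier_le_subset_eq hφ continuous_const hb.2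
          have hYb := (hY i).mono (inter_subset_right (s := U)) b hb.1
          rw [if_pos h0.le, hXY b hb.1 h0 i]
          exact hYb.mono_left (nhdsWithin_mono _ inter_subset_left)
        · exact (hX i).mono fun b hb => hb.1.1
        · exact (hY i).mono fun b hb => hb.1.2
      refine ContinuousOn.congr hg fun b _ => ?_
      by_cases h0 : φ b ≤ 0
      · simp only [if_pos h0]
      · simp only [if_neg h0]
    · by_cases h0 : φ b ≤ 0
      · simp only [if_pos h0, (hXs b hb.1).1]
      · simp only [if_neg h0, (hYs b hb.2).1]
  · obtain ⟨U, hU, X, hX, hs⟩ := hη.exists_frame b₀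
    refine ⟨U ∩ φ ⁻¹' Ioi 0, inter_mem hU (hφ.continuousAt.preimage_mem_nhds (Ioi_mem_nhds h)), X,
      fun i => (hX i).mono inter_subset_left, fun b hb => ?_⟩
    have : ¬ φ b ≤ 0 := not_le.2 hb.2
    rw [if_neg this, hs b hb.1]

theorem IsPlaneFieldAlong.comp {B' : Type*} [TopologicalSpace B'] {g : B' → B}
    {ξ : ∀ b, Submodule ℝ (TangentSpace (𝓡 3) (f b))} (h : IsPlaneFieldAlong f ξ)
    (hg : Continuous g) : IsPlaneFieldAlong (fun b => f (g b)) (fun b => ξ (g b)) := by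
  refine ⟨fun _ => h.finrank_eq _, fun b₀ => ?_⟩
  obtain ⟨U, hU, X, hX, hs⟩ := h.exists_frame (g b₀)
  exact ⟨g ⁻¹' U, hg.continuousAt.preimage_mem_nhds hU, fun i b => X i (g b),
    fun i => ContinuousOn.comp (hX i) hg.continuousOn fun _ hb => hb, fun _ hb => hs _ hb⟩

theorem IsFramingAlong.comp {B' : Type*} [TopologicalSpace B'] {g : B' → B}
    {o : ManifoldOrientation M} {X : Fin 3 → ∀ b, TangentSpace (𝓡 3) (f b)}
    (h : IsFramingAlong o f X) (hg : Continuous g) :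
    IsFramingAlong o (fun b => f (g b)) (fun i b => X i (g b)) :=
  ⟨fun i => ContinuousOn.comp (h.continuous i) hg.continuousOn fun _ _ => mem_univ _,
    fun _ => h.positive _⟩

end Gluing

theorem PlaneField.Homotopic.refl (ξ : PlaneField M) : ξ.Homotopic ξ :=
  ⟨fun p => ξ.plane p.2, ξ.isPlaneField.comp (g := fun p : unitInterval × M => p.2) continuous_snd,
    fun _ => rfl, fun _ => rfl⟩

theorem PlaneField.Homotopic.symm {ξ η : PlaneField M} (h : ξ.Homotopic η) : η.Homotopic ξ := by
  obtain ⟨ζ, hζ, h0, h1⟩ := h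
  refine ⟨fun p => ζ (unitInterval.symm p.1, p.2),
    hζ.comp (g := fun p : unitInterval × M => (unitInterval.symm p.1, p.2)) (by fun_prop),
    fun x => ?_, fun x => ?_⟩
  · have : ∀ t, t = 1 → ζ (t, x) = η.plane x := by rintro _ rfl; exact h1 x
    exact this _ unitInterval.symm_zero
  · have : ∀ t, t = 0 → ζ (t, x) = ξ.plane x := by rintro _ rfl; exact h0 x
    exact this _ unitInterval.symm_one

/-- The first and the second half of the unit interval, both stretched to the unit interval. -/
noncomputable def firstHalf (t : unitInterval) : unitInterval := projIcc 0 1 zero_le_one (2 * (t : ℝ))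

noncomputable def secondHalf (t : unitInterval) : unitInterval := projIcc 0 1 zero_le_one (2 * (t : ℝ) - 1)

theorem continuous_firstHalf : Continuous firstHalf :=
  continuous_projIcc.comp (by fun_prop)

theorem continuous_secondHalf : Continuous secondHalf :=
  continuous_projIcc.comp (by fun_prop)

theorem PlaneField.Homotopic.trans {ξ η θ : PlaneField M} (h : ξ.Homotopic η)
    (h' : η.Homotopic θ) : ξ.Homotopic θ := by
  obtain ⟨ζ, hζ, h0, h1⟩ := h
  obtain ⟨ζ', hζ', h0', h1'⟩ := h'
  have c1 : Continuous fun p : unitInterval × M => (firstHalf p.1, p.2) :=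
    (continuous_firstHalf.comp continuous_fst).prodMk continuous_snd
  have c2 : Continuous fun p : unitInterval × M => (secondHalf p.1, p.2) :=
    (continuous_secondHalf.comp continuous_fst).prodMk continuous_snd
  have hl : ∀ x t, t = 0 → ζ (t, x) = ξ.plane x := by rintro x _ rfl; exact h0 x
  have hm : ∀ x t, t = 1 → ζ (t, x) = η.plane x := by rintro x _ rfl; exact h1 x
  have hm' : ∀ x t, t = 0 → ζ' (t, x) = η.plane x := by rintro x _ rfl; exact h0' x
  have hr : ∀ x t, t = 1 → ζ' (t, x) = θ.plane x := by rintro x _ rfl; exact h1' x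
  refine ⟨fun p => if 2 * (p.1 : ℝ) - 1 ≤ 0 then ζ (firstHalf p.1, p.2)
    else ζ' (secondHalf p.1, p.2), ?_, fun x => ?_, fun x => ?_⟩
  · refine IsPlaneFieldAlong.glue (f := fun p : unitInterval × M => p.2)
      (ξ := fun p => ζ (firstHalf p.1, p.2)) (η := fun p => ζ' (secondHalf p.1, p.2))
      (φ := fun p : unitInterval × M => 2 * (p.1 : ℝ) - 1) continuous_snd (hζ.comp c1)
      (hζ'.comp c2) (by fun_prop) ?_
    rintro ⟨t, x⟩ ht
    simp only at ht
    exact (hm x _ (projIcc_of_right_le _ (by linarith))).trans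
      (hm' x _ (projIcc_of_le_left _ (by linarith))).symm
  · have h : (2 : ℝ) * ((0 : unitInterval) : ℝ) - 1 ≤ 0 := by simp
    simp only [if_pos h]
    exact hl x _ (projIcc_of_le_left _ (by simp))
  · have h : ¬ ((2 : ℝ) * ((1 : unitInterval) : ℝ) - 1 ≤ 0) := by norm_num
    simp only [if_neg h]
    exact hr x _ (projIcc_of_right_le _ (by norm_num))

theorem Framing.Homotopic.refl {o : ManifoldOrientation M} (X : Framing o) : X.Homotopic X :=
  ⟨fun i p => X.field i p.2, X.isFraming.comp (g := fun p : unitInterval × M => p.2) continuous_snd,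
    fun _ _ => rfl, fun _ _ => rfl⟩

theorem Framing.Homotopic.symm {o : ManifoldOrientation M} {X Y : Framing o} (h : X.Homotopic Y) :
    Y.Homotopic X := by
  obtain ⟨Z, hZ, h0, h1⟩ := h
  refine ⟨fun i p => Z i (unitInterval.symm p.1, p.2),
    hZ.comp (g := fun p : unitInterval × M => (unitInterval.symm p.1, p.2)) (by fun_prop),
    fun i x => ?_, fun i x => ?_⟩
  · have : ∀ t, t = 1 → Z i (t, x) = Y.field i x := by rintro _ rfl; exact h1 i x
    exact this _ unitInterval.symm_zero
  · have : ∀ t, t = 0 → Z i (t, x) = X.field i x := by rintro _ rfl; exact h0 i x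
    exact this _ unitInterval.symm_one

theorem Framing.Homotopic.trans {o : ManifoldOrientation M} {X Y W : Framing o}
    (h : X.Homotopic Y) (h' : Y.Homotopic W) : X.Homotopic W := by
  obtain ⟨Z, hZ, h0, h1⟩ := h
  obtain ⟨Z', hZ', h0', h1'⟩ := h'
  have c1 : Continuous fun p : unitInterval × M => (firstHalf p.1, p.2) :=
    (continuous_firstHalf.comp continuous_fst).prodMk continuous_snd
  have c2 : Continuous fun p : unitInterval × M => (secondHalf p.1, p.2) :=
    (continuous_secondHalf.comp continuous_fst).prodMk continuous_snd
  have hl := hZ.comp c1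
  have hr := hZ'.comp c2
  have k0 : ∀ i x t, t = 0 → Z i (t, x) = X.field i x := by rintro i x _ rfl; exact h0 i x
  have k1 : ∀ i x t, t = 1 → Z i (t, x) = Y.field i x := by rintro i x _ rfl; exact h1 i x
  have k0' : ∀ i x t, t = 0 → Z' i (t, x) = Y.field i x := by rintro i x _ rfl; exact h0' i x
  have k1' : ∀ i x t, t = 1 → Z' i (t, x) = W.field i x := by rintro i x _ rfl; exact h1' i x
  refine ⟨fun i p => if 2 * (p.1 : ℝ) ≤ 1 then Z i (firstHalf p.1, p.2)
    else Z' i (secondHalf p.1, p.2), ⟨fun i => ?_, fun p => ?_⟩, fun i x => ?_, fun i x => ?_⟩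
  · have hg : Continuous fun p : unitInterval × M => if 2 * (p.1 : ℝ) ≤ 1
        then (⟨p.2, Z i (firstHalf p.1, p.2)⟩ : TangentBundle (𝓡 3) M)
        else ⟨p.2, Z' i (secondHalf p.1, p.2)⟩ := by
      refine Continuous.if_le (continuousOn_univ.1 (hl.continuous i))
        (continuousOn_univ.1 (hr.continuous i)) (by fun_prop) continuous_const ?_
      rintro ⟨t, x⟩ ht
      simp only at ht
      exact congrArg (Bundle.TotalSpace.mk x) ((k1 i x _ (projIcc_of_right_le _ (by linarith))).trans
        (k0' i x _ (projIcc_of_le_left _ (by linarith))).symm)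
    refine ContinuousOn.congr hg.continuousOn fun p _ => ?_
    by_cases hp : 2 * (p.1 : ℝ) ≤ 1
    · simp only [if_pos hp]
    · simp only [if_neg hp]
  · by_cases hp : 2 * (p.1 : ℝ) ≤ 1
    · simpa only [if_pos hp] using hl.positive p
    · simpa only [if_neg hp] using hr.positive p
  · have h : (2 : ℝ) * ((0 : unitInterval) : ℝ) ≤ 1 := by simp
    simp only [if_pos h]
    exact k0 i x _ (projIcc_of_le_left _ (by simp))
  · have h : ¬ ((2 : ℝ) * ((1 : unitInterval) : ℝ) ≤ 1) := by simp
    simp only [if_neg h]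
    exact k1' i x _ (projIcc_of_right_le _ (by norm_num))

/-! ### Homotopy classes, and the plane field spanned by a framing -/

/-- Homotopy of framings, as an equivalence relation. -/
def Framing.homotopySetoid (o : ManifoldOrientation M) : Setoid (Framing o) :=
  ⟨Framing.Homotopic, Framing.Homotopic.refl, Framing.Homotopic.symm, Framing.Homotopic.trans⟩

/-- The homotopy classes of framings of the oriented 3-manifold `M`. -/
def FramingClass (o : ManifoldOrientation M) : Type u :=
  Quotient (Framing.homotopySetoid o)

/-- The homotopy class of a framing. -/
def Framing.homotopyClass {o : ManifoldOrientation M} (X : Framing o) : FramingClass o :=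
  Quotient.mk (Framing.homotopySetoid o) X

variable (M) in
/-- Homotopy through arbitrary tangent plane fields, as an equivalence relation on the orientable
plane fields with `c₁ = 0`. -/
def PlaneField.homotopySetoid : Setoid {ξ : PlaneField M // ξ.IsOrientableWithZeroChernClass} :=
  ⟨fun ξ η => ξ.1.Homotopic η.1, fun ξ => PlaneField.Homotopic.refl ξ.1,
    PlaneField.Homotopic.symm, PlaneField.Homotopic.trans⟩

variable (M) in
/-- The homotopy classes of orientable tangent plane fields with `c₁ = 0`. -/
def ZeroChernPlaneFieldClass : Type u :=
  Quotient (PlaneField.homotopySetoid M)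

/-- The homotopy class of an orientable tangent plane field with `c₁ = 0`. -/
def PlaneField.homotopyClass (ξ : PlaneField M) (h : ξ.IsOrientableWithZeroChernClass) :
    ZeroChernPlaneFieldClass M :=
  Quotient.mk (PlaneField.homotopySetoid M) ⟨ξ, h⟩

/-- The tangent plane field spanned by the first two vector fields of a framing. -/
noncomputable def Framing.planeField {o : ManifoldOrientation M} (X : Framing o) : PlaneField M where
  plane x := Submodule.span ℝ (range fun i : Fin 2 => X.field i.castSucc x)
  isPlaneField := by
    refine ⟨fun x => ?_, fun x₀ => ⟨univ, univ_mem, fun i => X.field i.castSucc,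
      fun i => X.isFraming.continuous _, fun _ _ => rfl⟩⟩
    obtain ⟨b, hb, -⟩ := X.isFraming.positive x
    have hli : LinearIndependent ℝ (fun i : Fin 2 => X.field i.castSucc x) := by
      have := b.linearIndependent.comp Fin.castSucc (Fin.castSucc_injective 2)
      rwa [hb] at this
    exact (finrank_span_eq_card hli).trans (Fintype.card_fin 2)

end Manifold

/-! A framing determines its plane field together with a frame of it, and the question is how much
freedom the frame carries. The map on homotopy classes is well defined because a path of framings
spans a path of plane fields, and the global frame `X₁, X₂` turns the plane field into a trivial
complex line bundle, with zero Chern cocycle.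

Injectivity has two steps. A homotopy from the plane field of `X` to that of `Y` is covered by a
homotopy of framings (`Framing.exists_homotopic_planeField_eq`): a continuous family of projections
`P` onto the planes yields maps `1 - P + P' * P` that carry one plane to a nearby one, and
compactness permits finitely many such steps. It remains to compare two framings that span the same
planes (`Framing.homotopic_of_planeField_eq`). Where they induce opposite orientations of the
planes, a half turn about the first field corrects the sign. After that, only the change of frame
inside the plane matters; up to a linear homotopy it is multiplication by a function `z : M → ℂ \
{0}`. Here the hypothesis on `M` enters: since `H₁(M; ℚ) = 0`, the increment of `log z` along a path
depends only on the ends of the path, hence `z = exp g` globally (`exists_continuous_exp_eq`), and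
`exp (t g)` joins 1 to `z`.

For surjectivity, if `c₁(ξ) = 0` then the logarithms of the transition functions can be changed by
integers into an additive cocycle. Partitions of unity make this cocycle a coboundary, whose
exponential rescales the local frames to a global one (`PlaneField.exists_frame_of_zeroChernClass`).
A third field exists because the positive completions of a plane frame form a convex set at each
point. -/

/-! ### Logarithms of nonvanishing functions -/

section Logarithm

open CategoryTheory
open scoped Simplicial

/-- A nonvanishing continuous function on a contractible space has a continuous logarithm. -/
theorem exists_continuous_exp_eq_of_contractible {A : Type*} [TopologicalSpace A]
    [ContractibleSpace A] (f : A → ℂ) (hf : Continuous f) (h0 : ∀ a, f a ≠ 0) :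
    ∃ g : A → ℂ, Continuous g ∧ ∀ a, Complex.exp (g a) = f a := by
  obtain ⟨p, ⟨H⟩⟩ := id_nullhomotopic A
  have cov := Complex.isCoveringMap_exp
  -- `H.symm` runs from the constant map `p` to the identity, so `K` starts at the constant `f p`,
  -- which is lifted by `Complex.log (f p)`, and ends at `f`. The homotopy lifted through the
  -- covering `exp` is a logarithm of `f` at time 1.
  let K : C(unitInterval × A, {z : ℂ // z ≠ 0}) :=
    ⟨fun q => ⟨f (H.symm q), h0 _⟩, by fun_prop⟩
  have hK : ∀ a, K (0, a) = (fun z : ℂ => (⟨_, z.exp_ne_zero⟩ : {z : ℂ // z ≠ 0}))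
      ((ContinuousMap.const A (Complex.log (f p)) : C(A, ℂ)) a) := by
    intro a
    refine Subtype.ext ?_
    change f (H.symm (0, a)) = Complex.exp (Complex.log (f p))
    rw [Complex.exp_log (h0 p)]
    simp
  refine ⟨fun a => cov.liftHomotopy K _ hK (1, a), by fun_prop, fun a => ?_⟩
  have := congrFun (cov.liftHomotopy_lifts K _ hK) (1, a)
  have := congrArg Subtype.val this
  simpa [K] using this

/-- After a shift that makes them agree at `b`, both functions are lifts through the covering `exp`
of the same map on a connected space, hence equal. This makes the increment of a logarithm
independent of the branch. -/
theorem exp_eq_exp_sub_const {A : Type*} [TopologicalSpace A] [PreconnectedSpace A]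
    {g g' : A → ℂ} (hg : Continuous g) (hg' : Continuous g')
    (h : ∀ a, Complex.exp (g a) = Complex.exp (g' a)) (a b : A) :
    g a - g b = g' a - g' b := by
  have cov := Complex.isCoveringMap_exp
  have key := cov.eq_of_comp_eq (g₁ := fun x => g x) (g₂ := fun x => g' x + (g b - g' b)) hg
    (by fun_prop) (funext fun x => Subtype.ext ?_) b (by ring)
  · have := congrFun key a
    linear_combination this
  · change Complex.exp _ = Complex.exp _
    rw [Complex.exp_add, Complex.exp_sub, h x, h b, div_self (Complex.exp_ne_zero _), mul_one]

instance stdSimplex.contractibleSpace (n : ℕ) : ContractibleSpace (stdSimplex ℝ (Fin (n + 1))) :=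
  (convex_stdSimplex ℝ (Fin (n + 1))).contractibleSpace ⟨_, single_mem_stdSimplex ℝ 0⟩

/-! ### Increments of logarithms and rational homology -/

variable {M : Type u} [TopologicalSpace M]

/-- The logarithm of `f` along a singular simplex. -/
theorem exists_log_simplex {f : M → ℂ} (hf : Continuous f) (h0 : ∀ x, f x ≠ 0) {n : ℕ}
    (s : (TopCat.toSSet.obj (TopCat.of M)) _⦋n⦌) :
    ∃ g : stdSimplex ℝ (Fin (n + 1)) → ℂ, Continuous g ∧
      ∀ a, Complex.exp (g a) = f ((TopCat.of M).toSSetObjEquiv _ s a) :=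
  exists_continuous_exp_eq_of_contractible _ (hf.comp (ContinuousMap.continuous _)) fun _ => h0 _

/-- The increment of the logarithm of `f` along a singular 1-simplex. -/
noncomputable def logIncrement {f : M → ℂ} (hf : Continuous f) (h0 : ∀ x, f x ≠ 0)
    (s : (TopCat.toSSet.obj (TopCat.of M)) _⦋1⦌) : ℂ :=
  (exists_log_simplex hf h0 s).choose (stdSimplex.vertex 1) -
    (exists_log_simplex hf h0 s).choose (stdSimplex.vertex 0)

theorem logIncrement_eq {f : M → ℂ} (hf : Continuous f) (h0 : ∀ x, f x ≠ 0)
    (s : (TopCat.toSSet.obj (TopCat.of M)) _⦋1⦌) {g : stdSimplex ℝ (Fin 2) → ℂ}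
    (hg : Continuous g) (h : ∀ a, Complex.exp (g a) = f ((TopCat.of M).toSSetObjEquiv _ s a)) :
    logIncrement hf h0 s = g (stdSimplex.vertex 1) - g (stdSimplex.vertex 0) := by
  have hs := (exists_log_simplex hf h0 s).choose_spec
  have : PathConnectedSpace (stdSimplex ℝ (Fin 2)) := inferInstance
  exact exp_eq_exp_sub_const hs.1 hg (fun a => (hs.2 a).trans (h a).symm) _ _

/-- One logarithm over the whole 2-simplex restricts to logarithms on its three faces, and the
increments telescope. Thus `logIncrement` is a singular 1-cocycle. -/
theorem logIncrement_face {f : M → ℂ} (hf : Continuous f) (h0 : ∀ x, f x ≠ 0)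
    (s : (TopCat.toSSet.obj (TopCat.of M)) _⦋2⦌) :
    logIncrement hf h0 ((TopCat.toSSet.obj (TopCat.of M)).δ 0 s) -
      logIncrement hf h0 ((TopCat.toSSet.obj (TopCat.of M)).δ 1 s) +
      logIncrement hf h0 ((TopCat.toSSet.obj (TopCat.of M)).δ 2 s) = 0 := by
  obtain ⟨g, hg, h⟩ := exists_log_simplex hf h0 s
  have key : ∀ i : Fin 3, logIncrement hf h0 ((TopCat.toSSet.obj (TopCat.of M)).δ i s) =
      g (stdSimplex.vertex (i.succAbove 1)) - g (stdSimplex.vertex (i.succAbove 0)) := by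
    intro i
    rw [logIncrement_eq hf h0 _ (g := fun a => g (stdSimplex.map i.succAbove a))
      (hg.comp (stdSimplex.continuous_map _))]
    · simp only [stdSimplex.map_vertex]
    · intro a
      rw [h]
      exact congrArg f (TopCat.toSSetObjEquiv_δ_apply s i a).symm
  rw [key, key, key]
  have e1 : (0 : Fin 3).succAbove (1 : Fin 2) = 2 := rfl
  have e2 : (0 : Fin 3).succAbove (0 : Fin 2) = 1 := rfl
  have e3 : (1 : Fin 3).succAbove (1 : Fin 2) = 2 := rfl
  have e4 : (1 : Fin 3).succAbove (0 : Fin 2) = 0 := rfl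
  have e5 : (2 : Fin 3).succAbove (1 : Fin 2) = 1 := rfl
  have e6 : (2 : Fin 3).succAbove (0 : Fin 2) = 0 := rfl
  rw [e1, e2, e3, e4, e5, e6]
  ring

/-- If `H₁(M; ℚ) = 0`, then the increment of the logarithm of `f` along a singular 1-simplex depends
only on the ends of the simplex. -/
theorem logIncrement_congr (hM : Subsingleton (rationalHomology M 1)) {f : M → ℂ}
    (hf : Continuous f) (h0 : ∀ x, f x ≠ 0) (s s' : (TopCat.toSSet.obj (TopCat.of M)) _⦋1⦌)
    (hs0 : (TopCat.toSSet.obj (TopCat.of M)).δ 0 s = (TopCat.toSSet.obj (TopCat.of M)).δ 0 s')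
    (hs1 : (TopCat.toSSet.obj (TopCat.of M)).δ 1 s = (TopCat.toSSet.obj (TopCat.of M)).δ 1 s') :
    logIncrement hf h0 s = logIncrement hf h0 s' := by
  let S := TopCat.toSSet.obj (TopCat.of M)
  let R : ModuleCat.{u} ℚ := ModuleCat.of ℚ (ULift.{u} ℚ)
  let K := S.chainComplex R
  have hK : K.ExactAt 1 := by
    rw [HomologicalComplex.exactAt_iff_isZero_homology]
    exact @ModuleCat.isZero_of_subsingleton _ _ _ hM
  rw [K.exactAt_iff' 2 1 0 (by simp) (by simp)] at hK
  -- The cocycle takes values in `ℂ`, regarded as a rational vector space, so that it extends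
  -- linearly to chains with rational coefficients.
  let T : ModuleCat.{u} ℚ := ModuleCat.of ℚ (ULift.{u} ℂ)
  let φ : S _⦋1⦌ → (R ⟶ T) := fun s => ModuleCat.ofHom
    (ULift.moduleEquiv.symm.toLinearMap ∘ₗ
      (LinearMap.toSpanSingleton ℚ ℂ (logIncrement hf h0 s)) ∘ₗ ULift.moduleEquiv.toLinearMap)
  have hφ : ∀ s q, φ s q = ULift.up (q.down • logIncrement hf h0 s) := fun _ _ => rfl
  let Φ : K.X 1 ⟶ T := Limits.Cofan.IsColimit.desc (S.isColimitChainComplexXCofan R 1) φ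
  have hΦ : ∀ s, S.ιChainComplex s ≫ Φ = φ s := fun s =>
    Limits.Cofan.IsColimit.fac (S.isColimitChainComplexXCofan R 1) φ s
  have hd : K.d 2 1 ≫ Φ = 0 := by
    refine SSet.chainComplex_hom_ext fun t => ?_
    rw [SSet.ιChainComplex_d_assoc, Limits.comp_zero]
    have hsum : φ (S.δ 0 t) - φ (S.δ 1 t) + φ (S.δ 2 t) = 0 := by
      ext q
      change (φ (S.δ 0 t) q - φ (S.δ 1 t) q + φ (S.δ 2 t) q).down = 0
      rw [hφ, hφ, hφ]
      change q.down • _ - q.down • _ + q.down • _ = (0 : ℂ)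
      rw [← smul_sub, ← smul_add, logIncrement_face hf h0 t, smul_zero]
    rw [← hsum, Fin.sum_univ_three]
    simp only [Preadditive.add_comp, Preadditive.zsmul_comp, hΦ]
    simp [sub_eq_add_neg]
  -- Equal end points make `s - s'` a cycle. By exactness in degree 1, a functional that vanishes on
  -- boundaries also vanishes on it.
  have hι : (S.ιChainComplex s - S.ιChainComplex s') ≫ K.d 1 0 = (0 : R ⟶ _) := by
    rw [Preadditive.sub_comp, SSet.ιChainComplex_d, SSet.ιChainComplex_d, sub_eq_zero]
    refine Finset.sum_congr rfl fun i _ => ?_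
    have hi : S.δ i s = S.δ i s' := by
      fin_cases i
      exacts [hs0, hs1]
    rw [hi]
  have hz : φ s - φ s' = 0 := by
    rw [← hΦ s, ← hΦ s', ← Preadditive.sub_comp]
    exact hK.comp_eq_zero hι hd
  have h1 := congrArg (fun h : R ⟶ T => (h (ULift.up 1)).down) hz
  have h2 : (φ s (ULift.up 1)).down - (φ s' (ULift.up 1)).down = 0 := h1
  rw [hφ, hφ, one_smul, one_smul] at h2
  exact sub_eq_zero.1 h2

/-- If `H₁(M; ℚ) = 0`, then the increment of the logarithm of `f` along a path depends only on the
ends of the path. -/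
theorem log_path_congr (hM : Subsingleton (rationalHomology M 1)) {f : M → ℂ}
    (hf : Continuous f) (h0 : ∀ x, f x ≠ 0) (γ γ' : C(unitInterval, M)) (hγ0 : γ 0 = γ' 0)
    (hγ1 : γ 1 = γ' 1) {g g' : unitInterval → ℂ} (hg : Continuous g) (hg' : Continuous g')
    (h : ∀ t, Complex.exp (g t) = f (γ t)) (h' : ∀ t, Complex.exp (g' t) = f (γ' t)) :
    g 1 - g 0 = g' 1 - g' 0 := by
  let E := stdSimplexHomeomorphUnitInterval
  let σ : C(unitInterval, M) → (TopCat.toSSet.obj (TopCat.of M)) _⦋1⦌ := fun γ =>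
    ((TopCat.of M).toSSetObjEquiv _).symm (γ.comp ⟨E, E.continuous⟩)
  have hσ : ∀ γ a, (TopCat.of M).toSSetObjEquiv _ (σ γ) a = γ (E a) := fun _ _ => rfl
  have hE0 : E (stdSimplex.vertex 0) = 0 := stdSimplexHomeomorphUnitInterval_zero
  have hE1 : E (stdSimplex.vertex 1) = 1 := stdSimplexHomeomorphUnitInterval_one
  have hface : ∀ i : Fin 2, γ (E (stdSimplex.vertex (i.succAbove 0))) =
      γ' (E (stdSimplex.vertex (i.succAbove 0))) → (TopCat.toSSet.obj (TopCat.of M)).δ i (σ γ) =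
        (TopCat.toSSet.obj (TopCat.of M)).δ i (σ γ') := by
    intro i hi
    refine ((TopCat.of M).toSSetObjEquiv _).injective (ContinuousMap.ext fun a => ?_)
    obtain rfl : a = stdSimplex.vertex (0 : Fin 1) := Subsingleton.elim _ _
    refine (TopCat.toSSetObjEquiv_δ_apply (σ γ) i _).trans
      (Eq.trans ?_ (TopCat.toSSetObjEquiv_δ_apply (σ γ') i _).symm)
    rw [stdSimplex.map_vertex]
    exact hi
  have key := logIncrement_congr hM hf h0 (σ γ) (σ γ') (hface 0 ?_) (hface 1 ?_)
  · rw [logIncrement_eq hf h0 (σ γ) (hg.comp E.continuous) fun a => h _,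
      logIncrement_eq hf h0 (σ γ') (hg'.comp E.continuous) fun a => h' _] at key
    simpa only [Function.comp_apply, hE0, hE1] using key
  · change γ (E (stdSimplex.vertex 1)) = γ' (E (stdSimplex.vertex 1))
    rw [hE1, hγ1]
  · change γ (E (stdSimplex.vertex 0)) = γ' (E (stdSimplex.vertex 0))
    rw [hE0, hγ0]

/-- If `H₁(M; ℚ) = 0`, then every nonvanishing continuous function on `M` has a continuous
logarithm. -/
theorem exists_continuous_exp_eq [LocallyPathConnectedSpace M]
    (hM : Subsingleton (rationalHomology M 1)) {f : M → ℂ} (hf : Continuous f)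
    (h0 : ∀ x, f x ≠ 0) : ∃ g : M → ℂ, Continuous g ∧ ∀ x, Complex.exp (g x) = f x := by
  have cov := Complex.isCoveringMap_exp
  have key : ∀ x₀ : M, ∃ g : M → ℂ, ContinuousOn g (pathComponent x₀) ∧
      ∀ x ∈ pathComponent x₀, Complex.exp (g x) = f x := by
    intro x₀
    have : PathConnectedSpace (pathComponent x₀) :=
      isPathConnected_iff_pathConnectedSpace.1 isPathConnected_pathComponent
    have hopen : IsOpen (pathComponent x₀) := IsOpen.pathComponent x₀
    have : LocallyPathConnectedSpace (pathComponent x₀) := hopen.locallyPathConnectedSpace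
    let F : C(pathComponent x₀, {z : ℂ // z ≠ 0}) := ⟨fun x => ⟨f x, h0 _⟩, by fun_prop⟩
    let a₀ : pathComponent x₀ := ⟨x₀, mem_pathComponent_self x₀⟩
    have he : (fun z : ℂ => (⟨_, z.exp_ne_zero⟩ : {z : ℂ // z ≠ 0})) (Complex.log (f x₀)) =
        F a₀ := Subtype.ext (Complex.exp_log (h0 x₀))
    -- Lifting criterion on a path component: every path from `x₀` lifts, and by `log_path_congr`
    -- the end of the lift depends only on the end of the path.
    obtain ⟨G, ⟨-, hG⟩, -⟩ := cov.isLocalHomeomorph.existsUnique_continuousMap_lifts F a₀ _ he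
      (fun γ γ0 => by
        obtain ⟨Γ, h1, h2⟩ := cov.exists_path_lifts (F.comp γ) (Complex.log (f x₀))
          (by rw [ContinuousMap.comp_apply, γ0]; exact he.symm)
        exact ⟨Γ, h2, h1⟩)
      (fun γ γ' Γ Γ' γ0 γ0' Γ0 Γ0' hΓ hΓ' h1 => by
        have := log_path_congr hM hf h0
          ((ContinuousMap.mk Subtype.val continuous_subtype_val).comp γ)
          ((ContinuousMap.mk Subtype.val continuous_subtype_val).comp γ')
          (by simp [γ0, γ0']) (by simp [h1]) Γ.continuous Γ'.continuous
          (fun t => congrArg Subtype.val (congrFun hΓ t))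
          (fun t => congrArg Subtype.val (congrFun hΓ' t))
        rw [Γ0, Γ0'] at this
        exact sub_left_inj.1 this)
    classical
    refine ⟨fun x => if hx : x ∈ pathComponent x₀ then G ⟨x, hx⟩ else 0, ?_, fun x hx => ?_⟩
    · rw [continuousOn_iff_continuous_domRestrict]
      convert G.continuous using 1
      ext x
      simp [x.2]
    · simp only [dif_pos hx]
      exact congrArg Subtype.val (congrFun hG ⟨x, hx⟩)
  choose g hg hgf using key
  -- One base point for each path component. Since `r` is constant on components and these are open,
  -- the local logarithms glue.
  let r : M → M := fun x => Quotient.out (Quotient.mk (pathSetoid M) x)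
  have hr : ∀ x, x ∈ pathComponent (r x) := fun x => Quotient.mk_out (s := pathSetoid M) x
  refine ⟨fun x => g (r x) x, continuous_iff_continuousAt.2 fun x => ?_,
    fun x => hgf _ _ (hr x)⟩
  have hopen : pathComponent (r x) ∈ 𝓝 x := (IsOpen.pathComponent _).mem_nhds (hr x)
  refine ((hg (r x)).continuousAt hopen).congr ?_
  filter_upwards [hopen] with y hy
  have : r y = r x := by
    refine congrArg Quotient.out (Quotient.sound (s := pathSetoid M) ?_)
    exact (Joined.symm hy).trans (hr x)
  rw [this]

end Logarithm

/-! ### Frames and their transition matrices -/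

section LinearAlgebra

variable {ι V : Type*} [Fintype ι] [DecidableEq ι] [AddCommGroup V] [Module ℝ V]
  {o : Orientation ℝ V ι} {v : ι → V}

theorem IsPositiveFrame.linearIndependent (h : IsPositiveFrame o v) : LinearIndependent ℝ v := by
  obtain ⟨b, rfl, -⟩ := h
  exact b.linearIndependent

theorem IsPositiveFrame.exists_eq_sum (h : IsPositiveFrame o v) (w : V) :
    ∃ c : ι → ℝ, w = ∑ j, c j • v j := by
  obtain ⟨b, rfl, -⟩ := h
  exact ⟨b.repr w, (b.sum_repr w).symm⟩

theorem IsPositiveFrame.sum_smul_iff (h : IsPositiveFrame o v) (A : Matrix ι ι ℝ) :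
    IsPositiveFrame o (fun i => ∑ j, A j i • v j) ↔ 0 < A.det := by
  obtain ⟨b, rfl, rfl⟩ := h
  have hdet : b.det (fun i => ∑ j, A j i • b j) = A.det := by
    rw [Basis.det_apply]
    congr 1
    ext k i
    simp [Basis.toMatrix_apply, Finsupp.single_apply]
  constructor
  · rintro ⟨b', hb', hor⟩
    rw [← hdet, ← hb']
    exact (b.orientation_eq_iff_det_pos b').1 hor.symm
  · intro hA
    have hb := (Module.Basis.is_basis_iff_det b).2 (show IsUnit (b.det (fun i => ∑ j, A j i • b j)) by
      rw [hdet]; exact isUnit_iff_ne_zero.2 hA.ne')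
    refine ⟨Basis.mk hb.1 hb.2.ge, Basis.coe_mk _ _, ?_⟩
    refine ((b.orientation_eq_iff_det_pos _).2 ?_).symm
    rw [Basis.coe_mk, hdet]
    exact hA

end LinearAlgebra

section Manifold

variable {M : Type u} [TopologicalSpace M] [ChartedSpace (EuclideanSpace ℝ (Fin 3)) M]
  [IsManifold (𝓡 3) ∞ M] {B : Type*} [TopologicalSpace B] {f : B → M}

/-- The coefficients of a continuous field with respect to a continuous frame are continuous. -/
theorem ContinuousFieldOn.continuousOn_coeff {X : Fin 3 → ∀ b, TangentSpace (𝓡 3) (f b)}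
    {s : Set B} (hf : Continuous f) (hX : ∀ i, ContinuousFieldOn f (X i) s)
    (hli : ∀ b ∈ s, LinearIndependent ℝ (fun i => X i b)) {c : B → Fin 3 → ℝ}
    (hc : ContinuousFieldOn f (fun b => ∑ j, c b j • X j b) s) : ContinuousOn c s := by
  intro b₀ hb₀
  set e := trivializationAt (EuclideanSpace ℝ (Fin 3)) (TangentSpace (𝓡 3) (M := M)) (f b₀)
  have he : f b₀ ∈ e.baseSet := FiberBundle.mem_baseSet_trivializationAt' (f b₀)
  set W := s ∩ f ⁻¹' e.baseSet
  let A : B → Matrix (Fin 3) (Fin 3) ℝ := fun b =>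
    Matrix.of fun k j => e.linearMapAt ℝ (f b) (X j b) k
  have hA : ContinuousOn A W := by
    refine continuousOn_pi.2 fun k => continuousOn_pi.2 fun j => ?_
    exact (EuclideanSpace.proj (𝕜 := ℝ) k).continuous.comp_continuousOn
      ((hX j).continuousOn_linearMapAt (f b₀))
  let w : B → Fin 3 → ℝ := fun b k => e.linearMapAt ℝ (f b) (∑ j, c b j • X j b) k
  have hw : ContinuousOn w W := by
    refine continuousOn_pi.2 fun k => ?_
    exact (EuclideanSpace.proj (𝕜 := ℝ) k).continuous.comp_continuousOn
      (hc.continuousOn_linearMapAt (f b₀))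
  have hAc : ∀ b, (A b).mulVec (c b) = w b := by
    intro b
    ext k
    simp only [w, map_sum, map_smul, Matrix.mulVec, dotProduct, A, Matrix.of_apply]
    simp [mul_comm]
  have hdet0 : ∀ b ∈ W, (A b).det ≠ 0 := by
    intro b hb
    have hcol : LinearIndependent ℝ (A b).col := by
      have : (A b).col = ((EuclideanSpace.equiv (Fin 3) ℝ).toLinearEquiv.toLinearMap ∘ₗ
          e.linearMapAt ℝ (f b)) ∘ (fun j => X j b) := rfl
      rw [this]
      refine (hli b hb.1).map' _ (LinearMap.ker_eq_bot.2 ?_)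
      refine fun x y hxy => ?_
      have hxy' : e.linearMapAt ℝ (f b) x = e.linearMapAt ℝ (f b) y :=
        (EuclideanSpace.equiv (Fin 3) ℝ).injective hxy
      have := congrArg (e.symmₗ ℝ (f b)) hxy'
      rwa [e.symmₗ_linearMapAt hb.2, e.symmₗ_linearMapAt hb.2] at this
    have := Matrix.linearIndependent_cols_iff_isUnit.1 hcol
    exact ((Matrix.isUnit_iff_isUnit_det _).1 this).ne_zero
  have hcW : ContinuousOn c W := by
    -- Cramer's rule in a local trivialization: the adjugate and the inverse of a nonzero
    -- determinant depend continuously on the frame.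
    have h2 : ContinuousOn (fun b => ((A b).det)⁻¹ • (A b).adjugate.mulVec (w b)) W := by
      rw [continuousOn_iff_continuous_domRestrict] at hA hw ⊢
      exact (hA.matrix_det.inv₀ fun b => hdet0 b.1 b.2).smul (hA.matrix_adjugate.matrix_mulVec hw)
    refine h2.congr fun b hb => ?_
    simp only
    rw [← hAc, Matrix.mulVec_mulVec, Matrix.adjugate_mul, Matrix.smul_mulVec, Matrix.one_mulVec,
      smul_smul, inv_mul_cancel₀ (hdet0 b hb), one_smul]
  refine (hcW b₀ ⟨hb₀, he⟩).mono_of_mem_nhdsWithin ?_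
  exact inter_mem_nhdsWithin _ (hf.continuousAt.preimage_mem_nhds (e.open_baseSet.mem_nhds he))

/-- The fields with coefficients `A` with respect to the fields `X`. -/
noncomputable def transformFrame (A : B → Matrix (Fin 3) (Fin 3) ℝ)
    (X : Fin 3 → ∀ b, TangentSpace (𝓡 3) (f b)) :
    Fin 3 → ∀ b, TangentSpace (𝓡 3) (f b) :=
  fun i b => ∑ j, A b j i • X j b

variable {o : ManifoldOrientation M}

theorem IsFramingAlong.transform {X : Fin 3 → ∀ b, TangentSpace (𝓡 3) (f b)} (hf : Continuous f)
    (hX : IsFramingAlong o f X) {A : B → Matrix (Fin 3) (Fin 3) ℝ} (hA : Continuous A)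
    (hdet : ∀ b, 0 < (A b).det) : IsFramingAlong o f (transformFrame A X) where
  continuous i := ContinuousFieldOn.sum_smul hf hX.continuous fun j =>
    (hA.matrix_elem j i).continuousOn
  positive b := ((hX.positive b).sum_smul_iff (A b)).2 (hdet b)

/-- The columns of `A b` are the coordinates of the fields of `Y` in the frame `X`. Relative to one
framing, all others thus become continuous maps to matrices of positive determinant, and homotopies
of framings become paths of such maps. -/
theorem IsFramingAlong.exists_eq_transform {X Y : Fin 3 → ∀ b, TangentSpace (𝓡 3) (f b)}
    (hf : Continuous f) (hX : IsFramingAlong o f X) (hY : IsFramingAlong o f Y) :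
    ∃ A : B → Matrix (Fin 3) (Fin 3) ℝ, Continuous A ∧ (∀ b, 0 < (A b).det) ∧
      Y = transformFrame A X := by
  choose c hc using fun i b => (hX.positive b).exists_eq_sum (Y i b)
  let A : B → Matrix (Fin 3) (Fin 3) ℝ := fun b => Matrix.of fun j i => c i b j
  have hYA : Y = transformFrame A X := funext fun i => funext fun b => hc i b
  refine ⟨A, ?_, fun b => ?_, hYA⟩
  · refine continuous_pi fun j => continuous_pi fun i => ?_
    have h := ContinuousFieldOn.continuousOn_coeff hf hX.continuous
      (fun b _ => (hX.positive b).linearIndependent) (c := c i) (s := univ) (by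
        have := hY.continuous i
        rwa [funext (hc i)] at this)
    exact (continuous_apply j).comp (continuousOn_univ.1 h)
  · refine ((hX.positive b).sum_smul_iff (A b)).1 ?_
    have := hY.positive b
    rw [hYA] at this
    exact this

/-- The framing with coefficients `A` with respect to the framing `X`. -/
noncomputable def Framing.transform (X : Framing o) (A : M → Matrix (Fin 3) (Fin 3) ℝ)
    (hA : Continuous A) (hdet : ∀ x, 0 < (A x).det) : Framing o where
  field := transformFrame (f := id) A X.field
  isFraming := X.isFraming.transform continuous_id hA hdet

theorem Framing.ext {X Y : Framing o} (h : X.field = Y.field) : X = Y := by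
  cases X; cases Y; cases h; rfl

theorem Framing.exists_eq_transform (X Y : Framing o) : ∃ A : M → Matrix (Fin 3) (Fin 3) ℝ,
    ∃ (hA : Continuous A) (hdet : ∀ x, 0 < (A x).det), Y = X.transform A hA hdet := by
  obtain ⟨A, hA, hdet, h⟩ := X.isFraming.exists_eq_transform continuous_id Y.isFraming
  exact ⟨A, hA, hdet, Framing.ext h⟩

/-- A path of matrices with positive determinants gives a homotopy of framings. -/
theorem Framing.homotopic_transform (X : Framing o)
    (A : unitInterval × M → Matrix (Fin 3) (Fin 3) ℝ) (hA : Continuous A)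
    (hdet : ∀ p, 0 < (A p).det) {A₀ A₁ : M → Matrix (Fin 3) (Fin 3) ℝ} (hA₀ : Continuous A₀)
    (hA₁ : Continuous A₁) (hdet₀ : ∀ x, 0 < (A₀ x).det) (hdet₁ : ∀ x, 0 < (A₁ x).det)
    (h0 : ∀ x, A (0, x) = A₀ x) (h1 : ∀ x, A (1, x) = A₁ x) :
    (X.transform A₀ hA₀ hdet₀).Homotopic (X.transform A₁ hA₁ hdet₁) := by
  refine ⟨transformFrame (f := fun p : unitInterval × M => p.2) A fun i p => X.field i p.2,
    (X.isFraming.comp (g := fun p : unitInterval × M => p.2) continuous_snd).transform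
      continuous_snd hA hdet, fun i x => ?_, fun i x => ?_⟩
  · change ∑ j, A (0, x) j i • X.field j x = ∑ j, A₀ x j i • X.field j x
    rw [h0]
  · change ∑ j, A (1, x) j i • X.field j x = ∑ j, A₁ x j i • X.field j x
    rw [h1]

theorem Framing.transform_one (X : Framing o) :
    X.transform (fun _ => 1) continuous_const (fun _ => by simp) = X := by
  refine Framing.ext (funext fun i => funext fun x => ?_)
  change ∑ j, (1 : Matrix (Fin 3) (Fin 3) ℝ) j i • X.field j x = X.field i x
  simp [Matrix.one_apply]

end Manifold

section Manifold

variable {M : Type u} [TopologicalSpace M] [ChartedSpace (EuclideanSpace ℝ (Fin 3)) M]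
  [IsManifold (𝓡 3) ∞ M] {o : ManifoldOrientation M}

/-! ### The plane field of a framing -/

theorem IsFramingAlong.linearIndependent_castSucc {B : Type*} [TopologicalSpace B] {f : B → M}
    {X : Fin 3 → ∀ b, TangentSpace (𝓡 3) (f b)} (hX : IsFramingAlong o f X) (b : B) :
    LinearIndependent ℝ (fun i : Fin 2 => X i.castSucc b) :=
  (hX.positive b).linearIndependent.comp Fin.castSucc (Fin.castSucc_injective 2)

theorem IsFramingAlong.isPlaneFieldAlong {B : Type*} [TopologicalSpace B] {f : B → M}
    {X : Fin 3 → ∀ b, TangentSpace (𝓡 3) (f b)} (hX : IsFramingAlong o f X) :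
    IsPlaneFieldAlong f
      (fun b => Submodule.span ℝ (range fun i : Fin 2 => X i.castSucc b)) where
  finrank_eq b := (finrank_span_eq_card (hX.linearIndependent_castSucc b)).trans (Fintype.card_fin 2)
  exists_frame _ := ⟨univ, univ_mem, fun i => X i.castSucc, fun _ => hX.continuous _,
    fun _ _ => rfl⟩

theorem IsPlaneFieldAlong.span_eq_of_linearIndependent {B : Type*} [TopologicalSpace B] {f : B → M}
    {ξ : ∀ b, Submodule ℝ (TangentSpace (𝓡 3) (f b))} (hξ : IsPlaneFieldAlong f ξ) (b : B)
    {v : Fin 2 → TangentSpace (𝓡 3) (f b)} (hv : LinearIndependent ℝ v) (hmem : ∀ i, v i ∈ ξ b) :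
    Submodule.span ℝ (range v) = ξ b := by
  have : FiniteDimensional ℝ (ξ b) :=
    Module.finite_of_finrank_pos (two_pos.trans_eq (hξ.finrank_eq b).symm)
  refine Submodule.eq_of_le_of_finrank_eq (Submodule.span_le.2 ?_) ?_
  · rintro _ ⟨i, rfl⟩
    exact hmem i
  · rw [finrank_span_eq_card hv, hξ.finrank_eq b, Fintype.card_fin]

theorem Framing.Homotopic.planeField {X Y : Framing o} (h : X.Homotopic Y) :
    X.planeField.Homotopic Y.planeField := by
  obtain ⟨Z, hZ, h0, h1⟩ := h
  refine ⟨_, hZ.isPlaneFieldAlong, fun x => ?_, fun x => ?_⟩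
  · simp only [h0]
    rfl
  · simp only [h1]
    rfl

/-- The vector fields `X₁`, `X₂` as a basis of the planes that they span. -/
noncomputable def Framing.planeBasis (X : Framing o) (x : M) :
    Basis (Fin 2) ℝ (X.planeField.plane x) :=
  Basis.span (X.isFraming.linearIndependent_castSucc x)

theorem Framing.coe_planeBasis (X : Framing o) (x : M) (i : Fin 2) :
    (X.planeBasis x i : TangentSpace (𝓡 3) x) = X.field i.castSucc x :=
  congrArg Subtype.val (Basis.span_apply (X.isFraming.linearIndependent_castSucc x) i)

theorem Framing.continuousFieldOn_planeBasis (X : Framing o) (i : Fin 2) (s : Set M) :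
    ContinuousFieldOn id (fun x => (X.planeBasis x i : TangentSpace (𝓡 3) x)) s := by
  simp only [X.coe_planeBasis]
  exact (X.isFraming.continuous _).mono (subset_univ s)

/-- The orientation of the plane field of a framing in which `X₁`, `X₂` is positive. -/
noncomputable def Framing.planeOrientation (X : Framing o) : X.planeField.PlaneOrientation where
  at_ x := (X.planeBasis x).orientation
  exists_frame _ := ⟨univ, univ_mem, fun i x => X.planeBasis x i,
    fun i => X.continuousFieldOn_planeBasis i univ, fun x _ => ⟨X.planeBasis x, rfl, rfl⟩⟩

/-- The same global frame serves at every index of the cover, so all transition functions are 1 and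
their logarithms can be taken to be 0. -/
theorem Framing.isOrientableWithZeroChernClass (X : Framing o) :
    X.planeField.IsOrientableWithZeroChernClass := by
  refine ⟨X.planeOrientation,
    { cover := ⟨fun _ => univ, fun _ => isOpen_univ, fun _ => mem_univ _⟩
      frame := fun _ i x => X.planeBasis x i
      continuous_frame := fun _ i => X.continuousFieldOn_planeBasis i _
      positive_frame := fun _ x _ => ⟨X.planeBasis x, rfl, rfl⟩
      logTransition := fun _ _ _ => 0
      continuous_logTransition := fun _ _ => continuousOn_const
      transition := ?_ }, 0, fun _ _ _ _ _ => by simp, rfl⟩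
  rintro a b x - g hg
  simp only [mul_zero, Complex.exp_zero] at hg
  simp [hg]

end Manifold

section Manifold

variable {M : Type u} [TopologicalSpace M] [ChartedSpace (EuclideanSpace ℝ (Fin 3)) M]
  [IsManifold (𝓡 3) ∞ M] {o : ManifoldOrientation M}

/-! ### Framings with the same plane field -/

/-- The matrix of the multiplication by `z` on the plane `ℂ` of `ℝ³ = ℂ × ℝ`. -/
def complexBlock (z : ℂ) : Matrix (Fin 3) (Fin 3) ℝ :=
  !![z.re, -z.im, 0; z.im, z.re, 0; 0, 0, 1]

theorem det_complexBlock (z : ℂ) : (complexBlock z).det = Complex.normSq z := by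
  simp [complexBlock, Matrix.det_fin_three, Complex.normSq_apply]

theorem det_complexBlock_pos {z : ℂ} (hz : z ≠ 0) : 0 < (complexBlock z).det := by
  rw [det_complexBlock]
  exact Complex.normSq_pos.2 hz

theorem continuous_matrix_fin_three {B : Type*} [TopologicalSpace B]
    {A : B → Matrix (Fin 3) (Fin 3) ℝ} (h : ∀ i j, Continuous fun b => A b i j) : Continuous A :=
  continuous_pi fun i => continuous_pi fun j => h i j

theorem Continuous.complexBlock {B : Type*} [TopologicalSpace B] {z : B → ℂ} (hz : Continuous z) :
    Continuous fun b => complexBlock (z b) := by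
  have h1 := Complex.continuous_re.comp hz
  have h2 := Complex.continuous_im.comp hz
  refine continuous_matrix_fin_three fun i j => ?_
  fin_cases i <;> fin_cases j <;> simp [_root_.complexBlock] <;> fun_prop

/-- If `H₁(M; ℚ) = 0`, then framings that differ by a field of complex rotations and dilations
of the plane spanned by the first two fields are homotopic. -/
theorem Framing.homotopic_transform_complexBlock [LocallyPathConnectedSpace M]
    (hM : Subsingleton (rationalHomology M 1)) (X : Framing o) {z : M → ℂ} (hz : Continuous z)
    (h0 : ∀ x, z x ≠ 0) :
    X.Homotopic (X.transform (fun x => complexBlock (z x)) hz.complexBlock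
      fun x => det_complexBlock_pos (h0 x)) := by
  obtain ⟨g, hg, hgz⟩ := exists_continuous_exp_eq hM hz h0
  -- With `z = exp g`, the path `exp (t g)` of nonvanishing functions joins 1 to `z`.
  have hc : Continuous fun p : unitInterval × M => Complex.exp (((p.1 : ℝ) : ℂ) * g p.2) := by
    fun_prop
  have := X.homotopic_transform (A₀ := fun _ => 1) _ hc.complexBlock
    (fun p => det_complexBlock_pos (Complex.exp_ne_zero _)) continuous_const hz.complexBlock
    (fun _ => by simp) (fun x => det_complexBlock_pos (h0 x)) (fun x => ?_) fun x => ?_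
  · rwa [X.transform_one] at this
  · ext i j
    fin_cases i <;> fin_cases j <;> simp [complexBlock]
  · simp [hgz]

/-- Framings that differ by matrices which preserve the plane of the first two coordinates and
its orientation are homotopic, if `H₁(M; ℚ) = 0`. -/
theorem Framing.homotopic_transform_of_block_pos [LocallyPathConnectedSpace M]
    (hM : Subsingleton (rationalHomology M 1)) (X : Framing o)
    {A : M → Matrix (Fin 3) (Fin 3) ℝ} (hA : Continuous A) (hdet : ∀ x, 0 < (A x).det)
    (h0 : ∀ x, A x 2 0 = 0) (h1 : ∀ x, A x 2 1 = 0)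
    (hpos : ∀ x, 0 < A x 0 0 * A x 1 1 - A x 0 1 * A x 1 0) :
    X.Homotopic (X.transform A hA hdet) := by
  have hdet' : ∀ x, (A x).det = (A x 0 0 * A x 1 1 - A x 0 1 * A x 1 0) * A x 2 2 := by
    intro x
    rw [Matrix.det_fin_three, h0, h1]
    ring
  have h22 : ∀ x, 0 < A x 2 2 := fun x =>
    pos_of_mul_pos_right (hdet' x ▸ hdet x) (hpos x).le
  -- The complex linear part of the upper left block. If `w` is the antilinear part, the determinant
  -- of the block is `|z|² - |w|²`; as this is positive, `z` has no zeros.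
  let z : M → ℂ := fun x =>
    ((A x 0 0 + A x 1 1) / 2 : ℝ) + ((A x 1 0 - A x 0 1) / 2 : ℝ) * Complex.I
  have hre : ∀ x, (z x).re = (A x 0 0 + A x 1 1) / 2 := fun x => by simp [z]
  have him : ∀ x, (z x).im = (A x 1 0 - A x 0 1) / 2 := fun x => by simp [z]
  have hent : ∀ i j, Continuous fun x => A x i j := fun i j => hA.matrix_elem i j
  have hz : Continuous z := by
    have h1 := hent 0 0
    have h2 := hent 0 1
    have h3 := hent 1 0
    have h4 := hent 1 1
    fun_prop
  have hz0 : ∀ x, z x ≠ 0 := by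
    intro x hx
    have e1 : A x 0 0 + A x 1 1 = 0 := by
      have := hre x
      rw [hx, Complex.zero_re] at this
      linarith
    have e2 : A x 1 0 - A x 0 1 = 0 := by
      have := him x
      rw [hx, Complex.zero_im] at this
      linarith
    have := hpos x
    rw [show A x 0 0 = -A x 1 1 by linarith, show A x 1 0 = A x 0 1 by linarith] at this
    nlinarith [sq_nonneg (A x 1 1), sq_nonneg (A x 0 1)]
  refine (X.homotopic_transform_complexBlock hM hz hz0).trans ?_
  refine X.homotopic_transform
    (fun p => (1 - (p.1 : ℝ)) • complexBlock (z p.2) + (p.1 : ℝ) • A p.2)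
    (((continuous_const.sub (continuous_subtype_val.comp continuous_fst)).smul
      (hz.complexBlock.comp continuous_snd)).add
      ((continuous_subtype_val.comp continuous_fst).smul (hA.comp continuous_snd))) ?_ _ _ _ _
    (fun x => by simp) (fun x => by simp)
  rintro ⟨t, x⟩
  have ht0 : 0 ≤ (t : ℝ) := t.2.1
  have ht1 : (t : ℝ) ≤ 1 := t.2.2
  have hD := hpos x
  -- On the segment the antilinear part is multiplied by `t`, so the block has determinant `|z|² -
  -- t²|w|² = (1 - t²)|z|² + t² D`, where `D` is the determinant of the block of `A`. The first two
  -- entries of the last column do not contribute, since the last row vanishes in the first two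
  -- places.
  have key : ((1 - (t : ℝ)) • complexBlock (z x) + (t : ℝ) • A x).det =
      ((1 - (t : ℝ) ^ 2) * (((A x 0 0 + A x 1 1) / 2) ^ 2 + ((A x 1 0 - A x 0 1) / 2) ^ 2) +
        (t : ℝ) ^ 2 * (A x 0 0 * A x 1 1 - A x 0 1 * A x 1 0)) *
      ((1 - t) + t * A x 2 2) := by
    rw [Matrix.det_fin_three]
    simp only [complexBlock, Matrix.add_apply, Matrix.smul_apply, h0, h1, hre, him, smul_eq_mul,
      Matrix.of_apply, Matrix.cons_val', Matrix.cons_val_zero, Matrix.cons_val_one, Matrix.cons_val]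
    ring
  simp only
  rw [key]
  have hn : A x 0 0 * A x 1 1 - A x 0 1 * A x 1 0 ≤
      ((A x 0 0 + A x 1 1) / 2) ^ 2 + ((A x 1 0 - A x 0 1) / 2) ^ 2 := by
    nlinarith [sq_nonneg (A x 0 0 - A x 1 1), sq_nonneg (A x 1 0 + A x 0 1)]
  refine mul_pos ?_ ?_
  · nlinarith [mul_le_mul_of_nonneg_left hn (show (0 : ℝ) ≤ 1 - (t : ℝ) ^ 2 by nlinarith)]
  · rcases eq_or_lt_of_le ht0 with h | h
    · rw [← h]; norm_num
    · have := mul_pos h (h22 x)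
      linarith

/-- The rotation by `s` about the first coordinate axis. -/
noncomputable def axisRotation (s : ℝ) : Matrix (Fin 3) (Fin 3) ℝ :=
  !![1, 0, 0; 0, Real.cos s, -Real.sin s; 0, Real.sin s, Real.cos s]

theorem det_axisRotation (s : ℝ) : (axisRotation s).det = 1 := by
  simp [axisRotation, Matrix.det_fin_three, ← sq]

theorem Continuous.axisRotation {B : Type*} [TopologicalSpace B] {s : B → ℝ} (hs : Continuous s) :
    Continuous fun b => axisRotation (s b) := by
  refine continuous_matrix_fin_three fun i j => ?_
  fin_cases i <;> fin_cases j <;> simp [_root_.axisRotation] <;> fun_prop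

/-- Framings that span the same plane field are homotopic, if `H₁(M; ℚ) = 0`. -/
theorem Framing.homotopic_of_planeField_eq [LocallyPathConnectedSpace M]
    (hM : Subsingleton (rationalHomology M 1)) {X Y : Framing o}
    (h : Y.planeField.plane = X.planeField.plane) : X.Homotopic Y := by
  obtain ⟨A, hA, hdet, rfl⟩ := X.exists_eq_transform Y
  -- The first two fields of the second framing lie in the span of the first two fields of `X`, so
  -- they have no third coordinate.
  have hzero : ∀ x, ∀ i : Fin 2, A x 2 i.castSucc = 0 := by
    intro x i
    have hmem : ∑ j, A x j i.castSucc • X.field j x ∈ X.planeField.plane x := by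
      rw [← h]
      exact Submodule.subset_span ⟨i, rfl⟩
    obtain ⟨c, hc⟩ := (Submodule.mem_span_range_iff_exists_fun ℝ).1 hmem
    have hli := (X.isFraming.positive x).linearIndependent
    have := Fintype.linearIndependent_iff.1 hli
      (fun j => A x j i.castSucc - (![c 0, c 1, 0] : Fin 3 → ℝ) j) (by
        simp only [sub_smul, Finset.sum_sub_distrib]
        rw [← hc, sub_eq_zero, Fin.sum_univ_three, Fin.sum_univ_two]
        simp) 2
    simpa using this
  have h0 : ∀ x, A x 2 0 = 0 := fun x => hzero x 0
  have h1 : ∀ x, A x 2 1 = 0 := fun x => hzero x 1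
  have hent : ∀ i j, Continuous fun x => A x i j := fun i j => hA.matrix_elem i j
  let D : M → ℝ := fun x => A x 0 0 * A x 1 1 - A x 0 1 * A x 1 0
  have hDc : Continuous D :=
    ((hent 0 0).mul (hent 1 1)).sub ((hent 0 1).mul (hent 1 0))
  have hD0 : ∀ x, D x ≠ 0 := by
    intro x hx
    have := hdet x
    rw [Matrix.det_fin_three, h0, h1] at this
    have h2 : D x * A x 2 2 = 0 := by rw [hx, zero_mul]
    simp only [D] at h2
    linarith
  -- A half turn where the two framings orient the plane oppositely, no rotation elsewhere. The
  -- angle is continuous because `D` has no zeros.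
  let θ : M → ℝ := fun x => if 0 ≤ D x then 0 else Real.pi
  have hθ : Continuous θ :=
    Continuous.if_le continuous_const continuous_const continuous_const hDc
      fun x hx => (hD0 x hx.symm).elim
  have hrot : ∀ {s : ℝ} {x : M}, 0 < (A x * axisRotation s).det := by
    intro s x
    rw [Matrix.det_mul, det_axisRotation, mul_one]
    exact hdet x
  have hA' : Continuous fun x => A x * axisRotation (θ x) := hA.matrix_mul hθ.axisRotation
  have e0 : ∀ x s, (A x * axisRotation s) 2 0 = 0 := by
    intro x s
    simp [Matrix.mul_apply, Fin.sum_univ_three, axisRotation, h0]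
  have ecos : ∀ x, Real.sin (θ x) = 0 := by
    intro x
    simp only [θ]
    split_ifs <;> simp
  refine (X.homotopic_transform_of_block_pos hM hA' (fun x => hrot) (fun x => e0 x _)
    (fun x => ?_) (fun x => ?_)).trans (Framing.Homotopic.symm ?_)
  · simp [Matrix.mul_apply, Fin.sum_univ_three, axisRotation, h1, ecos]
  · have : 0 < D x * Real.cos (θ x) := by
      simp only [θ]
      split_ifs with hx
      · simpa using lt_of_le_of_ne hx (hD0 x).symm
      · simpa using hx
    simp only [D] at this
    simp only [Matrix.mul_apply, Fin.sum_univ_three, axisRotation, ecos, Matrix.of_apply,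
      Matrix.cons_val', Matrix.cons_val_zero, Matrix.cons_val_one, Matrix.cons_val]
    linarith
  -- The rotation is undone by shrinking the angle to 0. In between, the plane field may move; only
  -- the determinant has to stay positive.
  · have hc : Continuous fun p : unitInterval × M => A p.2 * axisRotation ((p.1 : ℝ) * θ p.2) :=
      (hA.comp continuous_snd).matrix_mul (Continuous.axisRotation (by fun_prop))
    refine X.homotopic_transform _ hc (fun p => hrot) _ _ _ _ (fun x => ?_) (fun x => ?_)
    · have : axisRotation 0 = 1 := by
        ext i j
        fin_cases i <;> fin_cases j <;> simp [axisRotation]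
      simp [this]
    · simp

end Manifold

section Manifold

variable {M : Type u} [TopologicalSpace M] [ChartedSpace (EuclideanSpace ℝ (Fin 3)) M]
  [IsManifold (𝓡 3) ∞ M] {o : ManifoldOrientation M}

/-! ### Transport of framings along homotopies of plane fields -/

/-- The matrix with columns `a`, `b` and `a × b`. -/
def crossFrame (a b : Fin 3 → ℝ) : Matrix (Fin 3) (Fin 3) ℝ :=
  (Matrix.of ![a, b, crossProduct a b]).transpose

/-- The determinant is the squared length of `a × b`. The cross product thus completes two
independent vectors to a positive frame in a continuous way. -/
theorem det_crossFrame_pos {c : Fin 2 → Fin 3 → ℝ} (h : LinearIndependent ℝ c) :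
    0 < (crossFrame (c 0) (c 1)).det := by
  have hne : crossProduct (c 0) (c 1) ≠ 0 := by
    refine crossProduct_ne_zero_iff_linearIndependent.2 ?_
    have : ![c 0, c 1] = c := by
      ext i
      fin_cases i <;> rfl
    rwa [this]
  have hdet : (crossFrame (c 0) (c 1)).det =
      crossProduct (c 0) (c 1) ⬝ᵥ crossProduct (c 0) (c 1) := by
    rw [crossFrame, Matrix.det_transpose, Matrix.det_fin_three]
    simp only [cross_apply, dotProduct, Fin.sum_univ_three, Matrix.of_apply, Matrix.cons_val',
      Matrix.cons_val_zero, Matrix.cons_val_one, Matrix.cons_val]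
    ring
  rw [hdet]
  exact lt_of_le_of_ne (Finset.sum_nonneg fun i _ => mul_self_nonneg _)
    fun h => hne (dotProduct_self_eq_zero.1 h.symm)

theorem ContinuousOn.crossProduct {B : Type*} [TopologicalSpace B] {s : Set B}
    {a b : B → Fin 3 → ℝ} (ha : ContinuousOn a s) (hb : ContinuousOn b s) :
    ContinuousOn (fun x => crossProduct (a x) (b x)) s := by
  have h0 : ∀ k, ContinuousOn (fun x => a x k) s := fun k =>
    (continuous_apply k).comp_continuousOn ha
  have h1 : ∀ k, ContinuousOn (fun x => b x k) s := fun k =>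
    (continuous_apply k).comp_continuousOn hb
  refine continuousOn_pi.2 fun k => ?_
  simp only [cross_apply]
  fin_cases k
  · exact ((h0 1).mul (h1 2)).sub ((h0 2).mul (h1 1))
  · exact ((h0 2).mul (h1 0)).sub ((h0 0).mul (h1 2))
  · exact ((h0 0).mul (h1 1)).sub ((h0 1).mul (h1 0))

/-! ### Continuous families of projections onto a plane field -/

section Projection

variable {B : Type*} [TopologicalSpace B] {f : B → M}

/-- The projections, as matrices with respect to the frame `w`, onto the subspace `S`. -/
def frameProjections {V : Type*} [AddCommGroup V] [Module ℝ V] (w : Fin 3 → V)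
    (S : Submodule ℝ V) : Set (Matrix (Fin 3) (Fin 3) ℝ) :=
  {P | (∀ v, Fintype.linearCombination ℝ w (P.mulVec v) ∈ S) ∧
    ∀ v, Fintype.linearCombination ℝ w v ∈ S → P.mulVec v = v}

/-- Both defining conditions are affine in `P`. Convexity lets a partition of unity average local
projections into a global one. -/
theorem convex_frameProjections {V : Type*} [AddCommGroup V] [Module ℝ V] (w : Fin 3 → V)
    (S : Submodule ℝ V) : Convex ℝ (frameProjections w S) := by
  rintro P hP P' hP' a b - - hab
  refine ⟨fun v => ?_, fun v hv => ?_⟩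
  · rw [Matrix.add_mulVec, Matrix.smul_mulVec, Matrix.smul_mulVec, map_add, map_smul, map_smul]
    exact S.add_mem (S.smul_mem _ (hP.1 v)) (S.smul_mem _ (hP'.1 v))
  · rw [Matrix.add_mulVec, Matrix.smul_mulVec, Matrix.smul_mulVec, hP.2 v hv, hP'.2 v hv,
      ← add_smul, hab, one_smul]

/-- In the basis formed by the columns of `G`, this is the projection onto the first two basis
vectors along the third. -/
theorem mem_frameProjections_of_basis {V : Type*} [AddCommGroup V] [Module ℝ V] {w : Fin 3 → V}
    (hw : LinearIndependent ℝ w) {G : Matrix (Fin 3) (Fin 3) ℝ} (hG : G.det ≠ 0) :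
    G * Matrix.diagonal ![1, 1, 0] * G⁻¹ ∈ frameProjections w (Submodule.span ℝ
      (range fun i : Fin 2 => Fintype.linearCombination ℝ w (G.col i.castSucc))) := by
  have hinv : G⁻¹ * G = 1 := Matrix.nonsing_inv_mul _ (isUnit_iff_ne_zero.2 hG)
  have hcol : ∀ u : Fin 3 → ℝ, G.mulVec ((Matrix.diagonal ![1, 1, 0]).mulVec u) =
      u 0 • G.col 0 + u 1 • G.col 1 := by
    intro u
    ext k
    simp [Matrix.mulVec, dotProduct, Fin.sum_univ_three, Matrix.diagonal_apply, mul_comm]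
  refine ⟨fun v => ?_, fun v hv => ?_⟩
  · rw [← Matrix.mulVec_mulVec, ← Matrix.mulVec_mulVec, hcol, map_add, map_smul, map_smul]
    exact Submodule.add_mem _ (Submodule.smul_mem _ _ (Submodule.subset_span ⟨0, rfl⟩))
      (Submodule.smul_mem _ _ (Submodule.subset_span ⟨1, rfl⟩))
  · obtain ⟨a, ha⟩ := (Submodule.mem_span_range_iff_exists_fun ℝ).1 hv
    have hva : v = G.mulVec ((Matrix.diagonal ![1, 1, 0]).mulVec ![a 0, a 1, 0]) := by
      rw [hcol]
      refine (hw.fintypeLinearCombination_injective) ?_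
      rw [← ha, map_add, map_smul, map_smul, Fin.sum_univ_two]
      rfl
    have hdiag : ((Matrix.diagonal ![1, 1, 0] : Matrix (Fin 3) (Fin 3) ℝ)).mulVec
        ![a 0, a 1, 0] = ![a 0, a 1, 0] := by
      ext k
      rw [Matrix.mulVec_diagonal]
      fin_cases k <;> simp
    rw [hdiag] at hva
    rw [hva, ← Matrix.mulVec_mulVec, ← Matrix.mulVec_mulVec, Matrix.mulVec_mulVec _ G⁻¹ G, hinv,
      Matrix.one_mulVec, hdiag]

/-- There is a continuous family of projections onto the planes of a plane field. -/
theorem IsPlaneFieldAlong.exists_continuous_projection [NormalSpace B] [ParacompactSpace B]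
    (hf : Continuous f) {X : Fin 3 → ∀ b, TangentSpace (𝓡 3) (f b)} (hX : IsFramingAlong o f X)
    {ζ : ∀ b, Submodule ℝ (TangentSpace (𝓡 3) (f b))} (hζ : IsPlaneFieldAlong f ζ) :
    ∃ P : C(B, Matrix (Fin 3) (Fin 3) ℝ), ∀ b,
      P b ∈ frameProjections (fun j => X j b) (ζ b) := by
  refine exists_continuous_forall_mem_convex_of_local (fun b => convex_frameProjections _ _)
    fun b₀ => ?_
  obtain ⟨U, hU, Y, hY, hspan⟩ := hζ.exists_frame b₀
  choose c hc using fun i b => (hX.positive b).exists_eq_sum (Y i b)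
  have hcc : ∀ i, ContinuousOn (c i) U := fun i =>
    ContinuousFieldOn.continuousOn_coeff hf (fun j => (hX.continuous j).mono (subset_univ U))
      (fun b _ => (hX.positive b).linearIndependent) (by
        have := hY i
        rwa [funext (hc i)] at this)
  -- The coordinates of a local frame of the plane, completed by their cross product. The projection
  -- obtained by conjugating with `G` is then continuous on `U`.
  let G : B → Matrix (Fin 3) (Fin 3) ℝ := fun b => crossFrame (c 0 b) (c 1 b)
  have hGc : ContinuousOn G U := by
    refine continuousOn_pi.2 fun k => continuousOn_pi.2 fun j => ?_
    fin_cases j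
    · exact (continuous_apply k).comp_continuousOn (hcc 0)
    · exact (continuous_apply k).comp_continuousOn (hcc 1)
    · exact (continuous_apply k).comp_continuousOn ((hcc 0).crossProduct (hcc 1))
  have hG0 : ∀ b ∈ U, (G b).det ≠ 0 := by
    intro b hb
    have hli : LinearIndependent ℝ (fun i => Y i b) := by
      rw [linearIndependent_iff_card_eq_finrank_span]
      have := hζ.finrank_eq b
      rw [hspan b hb] at this
      simpa [Set.finrank] using this.symm
    refine (det_crossFrame_pos (c := fun i => c i b)
      (LinearIndependent.of_comp (Fintype.linearCombination ℝ fun j => X j b) ?_)).ne'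
    convert hli using 1
    exact funext fun i => (hc i b).symm
  refine ⟨U, hU, fun b => G b * Matrix.diagonal ![1, 1, 0] * (G b)⁻¹, ?_, fun b hb => ?_⟩
  · have : ContinuousOn (fun b => ((G b).det)⁻¹ • (G b * Matrix.diagonal ![1, 1, 0] *
        (G b).adjugate)) U := by
      rw [continuousOn_iff_continuous_domRestrict] at hGc ⊢
      exact (hGc.matrix_det.inv₀ fun b => hG0 b.1 b.2).smul
        ((hGc.matrix_mul continuous_const).matrix_mul hGc.matrix_adjugate)
    refine this.congr fun b _ => ?_
    simp [Matrix.inv_def]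
  · have := mem_frameProjections_of_basis (hX.positive b).linearIndependent (hG0 b hb)
    convert this using 1
    rw [hspan b hb]
    refine congrArg
      (fun v : Fin 2 → TangentSpace (𝓡 3) (f b) =>
        frameProjections (fun j => X j b) (Submodule.span ℝ (range v))) (funext fun i => ?_)
    rw [hc i b]
    fin_cases i <;> rfl

end Projection

/-- The deformation of the projection matrix `P` into the projection matrix `P'`. -/
def projectionTransport (P P' : Matrix (Fin 3) (Fin 3) ℝ) : Matrix (Fin 3) (Fin 3) ℝ :=
  1 - P + P' * P

/-- By continuity the determinant stays positive for `P'` near `P`, so short transports preserve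
positive frames. -/
theorem projectionTransport_self {P : Matrix (Fin 3) (Fin 3) ℝ} (h : P * P = P) :
    projectionTransport P P = 1 := by
  rw [projectionTransport, h, sub_add_cancel]

/-- On the image of `P` the transport acts as `P'`, so it carries vectors of the first plane into
the second. -/
theorem projectionTransport_mulVec {P P' : Matrix (Fin 3) (Fin 3) ℝ} {v : Fin 3 → ℝ}
    (h : P.mulVec v = v) : (projectionTransport P P').mulVec v = P'.mulVec v := by
  rw [projectionTransport, Matrix.add_mulVec, Matrix.sub_mulVec, ← Matrix.mulVec_mulVec, h,
    Matrix.one_mulVec, sub_self, zero_add]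

theorem frameProjections_mul_self {V : Type*} [AddCommGroup V] [Module ℝ V] {w : Fin 3 → V}
    {S : Submodule ℝ V} {P : Matrix (Fin 3) (Fin 3) ℝ} (hP : P ∈ frameProjections w S) :
    P * P = P :=
  Matrix.ext_of_mulVec_single fun i => by rw [← Matrix.mulVec_mulVec, hP.2 _ (hP.1 _)]

/-- A framing can be deformed along with the plane field that it spans. -/
theorem Framing.exists_homotopic_planeField_eq [T2Space M] [CompactSpace M] (X : Framing o)
    {η : PlaneField M} (h : X.planeField.Homotopic η) :
    ∃ Y : Framing o, X.Homotopic Y ∧ Y.planeField.plane = η.plane := by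
  obtain ⟨ζ, hζ, hζ0, hζ1⟩ := h
  have hX' := X.isFraming.comp (g := fun p : unitInterval × M => p.2) continuous_snd
  obtain ⟨P, hP⟩ := hζ.exists_continuous_projection continuous_snd hX'
  let N : unitInterval → unitInterval → M → Matrix (Fin 3) (Fin 3) ℝ := fun s t x =>
    projectionTransport (P (s, x)) (P (t, x))
  have hN : Continuous fun r : (unitInterval × unitInterval) × M => N r.1.1 r.1.2 r.2 := by
    have h1 : Continuous fun r : (unitInterval × unitInterval) × M => P (r.1.1, r.2) :=
      P.continuous.comp (by fun_prop)
    have h2 : Continuous fun r : (unitInterval × unitInterval) × M => P (r.1.2, r.2) :=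
      P.continuous.comp (by fun_prop)
    exact (continuous_const.sub h1).add (h2.matrix_mul h1)
  have hNself : ∀ s x, N s s x = 1 := fun s x =>
    projectionTransport_self (frameProjections_mul_self (hP (s, x)))
  -- The pairs of times whose transport has positive determinant on all of `M` form an open set,
  -- because projecting along the compact `M` is a closed map. This set contains the diagonal, hence
  -- a uniform neighbourhood of it.
  obtain ⟨δ, hδ, hNpos⟩ : ∃ δ > 0, ∀ s t : unitInterval, dist s t < δ →
      ∀ x, 0 < (N s t x).det := by
    let W : Set (unitInterval × unitInterval) := {q | ∀ x, 0 < (N q.1 q.2 x).det}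
    have hW : IsOpen W := by
      have hcl : IsClosed {r : (unitInterval × unitInterval) × M |
          (N r.1.1 r.1.2 r.2).det ≤ 0} := isClosed_le hN.matrix_det continuous_const
      have := isClosedMap_fst_of_compactSpace _ hcl
      rw [← isOpen_compl_iff] at this
      convert this using 1
      ext q
      simp [W]
    have hdiag : W ∈ uniformity unitInterval := by
      rw [← nhdsSet_diagonal_eq_uniformity, hW.mem_nhdsSet]
      rintro ⟨s, t⟩ (rfl : s = t) x
      simp only [hNself]
      simp
    obtain ⟨δ, hδ, hd⟩ := Metric.mem_uniformity_dist.1 hdiag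
    exact ⟨δ, hδ, fun s t hst => hd hst⟩
  have step : ∀ (s t : unitInterval), dist s t < δ → ∀ Y : Framing o,
      (∀ x, ∀ i : Fin 2, Y.field i.castSucc x ∈ ζ (s, x)) → ∃ Y' : Framing o, Y.Homotopic Y' ∧
        ∀ x, ∀ i : Fin 2, Y'.field i.castSucc x ∈ ζ (t, x) := by
    intro s t hst Y hY
    obtain ⟨A, hA, hdet, rfl⟩ := X.exists_eq_transform Y
    have hcol : ∀ x, ∀ i : Fin 2,
        (P (s, x)).mulVec ((A x).col i.castSucc) = (A x).col i.castSucc := fun x i =>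
      (hP (s, x)).2 _ (hY x i)
    -- The segment from `s` to `t` stays within `δ` of `s`, so transport from time `s` to the times
    -- `κ τ` is a path of framings that starts at `Y`.
    let κ : unitInterval → unitInterval := fun τ => ⟨(1 - τ) * s + τ * t,
      convex_Icc (0 : ℝ) 1 s.2 t.2 (sub_nonneg.2 τ.2.2) τ.2.1 (by ring)⟩
    have hκ : Continuous κ := Continuous.subtype_mk (by fun_prop) _
    have hκ0 : κ 0 = s := Subtype.ext (by simp [κ])
    have hκ1 : κ 1 = t := Subtype.ext (by simp [κ])
    have hκd : ∀ τ, dist s (κ τ) < δ := by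
      intro τ
      refine lt_of_le_of_lt ?_ hst
      rw [Subtype.dist_eq, Subtype.dist_eq, Real.dist_eq, Real.dist_eq]
      have : (s : ℝ) - κ τ = τ * (s - t) := by simp only [κ]; ring
      rw [this, abs_mul, abs_of_nonneg τ.2.1]
      exact mul_le_of_le_one_left (abs_nonneg _) τ.2.2
    have hpath : Continuous fun p : unitInterval × M => N s (κ p.1) p.2 * A p.2 :=
      (hN.comp (g := fun r : (unitInterval × unitInterval) × M => N r.1.1 r.1.2 r.2)
        (f := fun p : unitInterval × M => ((s, κ p.1), p.2)) (by fun_prop)).matrix_mul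
        (hA.comp continuous_snd)
    have hend : Continuous fun x : M => N s t x * A x :=
      (hN.comp (g := fun r : (unitInterval × unitInterval) × M => N r.1.1 r.1.2 r.2)
        (f := fun x : M => ((s, t), x)) (by fun_prop)).matrix_mul hA
    have hpos : ∀ t', dist s t' < δ → ∀ x, 0 < (N s t' x * A x).det := fun t' ht' x => by
      rw [Matrix.det_mul]
      exact mul_pos (hNpos s t' ht' x) (hdet x)
    refine ⟨X.transform _ hend (hpos t hst), X.homotopic_transform _ hpath
      (fun p => hpos _ (hκd p.1) p.2) _ _ _ _ (fun x => ?_) (fun x => ?_), fun x i => ?_⟩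
    · simp only [hκ0, hNself, one_mul]
    · simp only [hκ1]
    · have h2 : (N s t x * A x).col i.castSucc = (P (t, x)).mulVec ((A x).col i.castSucc) :=
        projectionTransport_mulVec (hcol x i)
      have := (hP (t, x)).1 ((A x).col i.castSucc)
      rw [← h2] at this
      exact this
  obtain ⟨n, hn⟩ := exists_nat_one_div_lt hδ
  -- Times `k / (n + 1)`, with steps shorter than `δ`; after `n + 1` steps time 1 is reached. The
  -- projection only truncates at 1, and truncation does not increase distances.
  let T : ℕ → unitInterval := fun k => projIcc 0 1 zero_le_one ((k : ℝ) / (n + 1))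
  have hT : ∀ k, dist (T k) (T (k + 1)) < δ := by
    intro k
    refine lt_of_le_of_lt ?_ hn
    rw [Subtype.dist_eq, Real.dist_eq]
    refine (abs_projIcc_sub_projIcc zero_le_one).trans (le_of_eq ?_)
    rw [abs_sub_comm, ← sub_div, Nat.cast_add_one, add_sub_cancel_left, abs_of_pos (by positivity)]
  have hind : ∀ k, ∃ Y : Framing o, X.Homotopic Y ∧
      ∀ x, ∀ i : Fin 2, Y.field i.castSucc x ∈ ζ (T k, x) := by
    intro k
    induction k with
    | zero =>
      refine ⟨X, Framing.Homotopic.refl X, fun x i => ?_⟩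
      have : T 0 = 0 := Subtype.ext (by simp [T])
      rw [this, hζ0]
      exact Submodule.subset_span ⟨i, rfl⟩
    | succ k ih =>
      obtain ⟨Y, hXY, hY⟩ := ih
      obtain ⟨Y', hYY', hY'⟩ := step _ _ (hT k) Y hY
      exact ⟨Y', hXY.trans hYY', hY'⟩
  obtain ⟨Y, hXY, hY⟩ := hind (n + 1)
  refine ⟨Y, hXY, funext fun x => ?_⟩
  have hlast : T (n + 1) = 1 := by
    have : (((n + 1 : ℕ) : ℝ) / (n + 1)) = 1 := by
      rw [Nat.cast_add_one]
      exact div_self (by positivity)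
    simp only [T, this]
    exact projIcc_right zero_le_one
  refine η.isPlaneField.span_eq_of_linearIndependent x
    (Y.isFraming.linearIndependent_castSucc x) fun i => ?_
  have := hY x i
  rw [hlast, hζ1] at this
  exact this

end Manifold

/-! ### Plane fields with vanishing first Chern class -/

/-- An additive 1-cocycle of continuous complex functions is a coboundary. -/
theorem PointedCover.exists_eq_sub_of_cocycle {M : Type u} [TopologicalSpace M] [NormalSpace M]
    [ParacompactSpace M] (V : PointedCover M) (h : M → M → M → ℂ)
    (hc : ∀ a b, ContinuousOn (h a b) (V.nbhd a ∩ V.nbhd b))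
    (hcoc : ∀ a b c, ∀ x ∈ V.nbhd a ∩ V.nbhd b ∩ V.nbhd c, h b c x - h a c x + h a b x = 0) :
    ∃ u : M → M → ℂ, (∀ a, ContinuousOn (u a) (V.nbhd a)) ∧
      ∀ a b, ∀ x ∈ V.nbhd a ∩ V.nbhd b, h a b x = u b x - u a x := by
  obtain ⟨ρ, hρ⟩ := PartitionOfUnity.exists_isSubordinate isClosed_univ V.nbhd V.isOpen
    fun x _ => mem_iUnion.2 ⟨x, V.mem x⟩
  -- The usual primitive `u a = ∑ ρ_c h c a`: the cocycle condition for `c, a, b` gives `h c b - h c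
  -- a = h a b`, and the weights sum to 1.
  refine ⟨fun a x => ∑ᶠ c, ρ c x • h c a x, fun a x₀ hx₀ => ?_, fun a b x hx => ?_⟩
  · refine ContinuousAt.continuousWithinAt ?_
    -- Near `x₀` only the indices `c` with `x₀` in the closed support of `ρ c` contribute. For
    -- these, `x₀` lies in `V.nbhd c`, where `h c a` is known to be continuous.
    have hev : (fun x => ∑ᶠ c, ρ c x • h c a x) =ᶠ[𝓝 x₀]
        fun x => ∑ c ∈ ρ.fintsupport x₀, ρ c x • h c a x := by
      filter_upwards [ρ.eventually_finsupport_subset x₀] with x hx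
      refine finsum_eq_sum_of_support_subset _ fun c hc => hx ?_
      rw [ρ.mem_finsupport]
      exact left_ne_zero_of_smul hc
    refine ContinuousAt.congr (tendsto_finsetSum _ fun c hc' => ?_) hev.symm
    have hxc : x₀ ∈ V.nbhd c := hρ c ((ρ.mem_fintsupport_iff x₀ c).1 hc')
    exact ((ρ c).continuous.continuousAt).smul ((hc c a).continuousAt
      (inter_mem ((V.isOpen c).mem_nhds hxc) ((V.isOpen a).mem_nhds hx₀)))
  · simp only
    rw [← ρ.sum_finsupport_smul_eq_finsum (x₀ := x) fun c => h c b,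
      ← ρ.sum_finsupport_smul_eq_finsum (x₀ := x) fun c => h c a, ← Finset.sum_sub_distrib]
    have : ∀ c ∈ ρ.finsupport x, ρ c x • h c b x - ρ c x • h c a x = ρ c x • h a b x := by
      intro c hc'
      have hxc : x ∈ V.nbhd c := hρ c (subset_closure ((ρ.mem_finsupport x).1 hc'))
      rw [← smul_sub]
      congr 1
      linear_combination -hcoc c a b x ⟨⟨hxc, hx.1⟩, hx.2⟩
    rw [Finset.sum_congr rfl this, ← Finset.sum_smul, ρ.sum_finsupport (mem_univ x), one_smul]

section Manifold

variable {M : Type u} [TopologicalSpace M] [ChartedSpace (EuclideanSpace ℝ (Fin 3)) M]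
  [IsManifold (𝓡 3) ∞ M] {o : ManifoldOrientation M}

/-- An oriented plane field with vanishing first Chern class has a global frame. -/
theorem PlaneField.exists_frame_of_zeroChernClass [T2Space M] [CompactSpace M] {ξ : PlaneField M}
    (h : ξ.IsOrientableWithZeroChernClass) : ∃ W : Fin 2 → ∀ x, TangentSpace (𝓡 3) x,
      (∀ i, ContinuousFieldOn id (W i) univ) ∧ (∀ x, LinearIndependent ℝ (fun i => W i x)) ∧
      ∀ x, Submodule.span ℝ (range fun i => W i x) = ξ.plane x := by
  obtain ⟨σ, A, n, hn, h0⟩ := h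
  have hn0 : (n : M → M → M → M → ℤ) ∈ cechCoboundaries M := by
    have := (QuotientAddGroup.eq_zero_iff n).1 h0.symm
    exact AddSubgroup.mem_addSubgroupOf.1 this
  obtain ⟨U, m, hm, hmn⟩ := hn0
  let V := A.cover.inf U
  have hVA : ∀ a, V.nbhd a ⊆ A.cover.nbhd a := fun a => inter_subset_left
  have hVU : ∀ a, V.nbhd a ⊆ U.nbhd a := fun a => inter_subset_right
  -- Subtracting the integers `m` leaves the transition functions `exp (2πi h)` unchanged and turns
  -- the logarithms into an additive cocycle.
  obtain ⟨u, huc, hu⟩ := V.exists_eq_sub_of_cocycle (fun a b x => A.logTransition a b x - m a b x)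
    (fun a b => ((A.continuous_logTransition a b).mono (inter_subset_inter (hVA a) (hVA b))).sub
      ((continuous_of_discreteTopology (f := fun k : ℤ => (k : ℂ))).comp_continuousOn
        ((hm a b).mono (inter_subset_inter (hVU a) (hVU b)))))
    (fun a b c x hx => by
      have e1 := hn a b c x ⟨⟨hVA a hx.1.1, hVA b hx.1.2⟩, hVA c hx.2⟩
      have e2 := hmn a b c x ⟨⟨hVU a hx.1.1, hVU b hx.1.2⟩, hVU c hx.2⟩
      have e3 : ((n : M → M → M → M → ℤ) a b c x : ℂ) = m b c x - m a c x + m a b x := by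
        rw [e2]; push_cast; ring
      linear_combination e3 - e1)
  -- From `h = u b - u a + m` with `m` an integer it follows that `z b * g = z a`. Hence the local
  -- frames multiplied by `z` agree on overlaps.
  let z : M → M → ℂ := fun a x => Complex.exp (-(2 * Real.pi * Complex.I * u a x))
  have hzc : ∀ a, ContinuousOn (z a) (V.nbhd a) := fun a =>
    Complex.continuous_exp.comp_continuousOn ((continuousOn_const.mul (huc a)).neg)
  let C : M → M → Matrix (Fin 2) (Fin 2) ℝ := fun a x =>
    !![(z a x).re, -(z a x).im; (z a x).im, (z a x).re]
  let F : M → Fin 2 → ∀ x, ξ.plane x := fun a i x => ∑ j, C a x j i • A.frame a j x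
  have hF : ∀ a b, ∀ x ∈ V.nbhd a ∩ V.nbhd b, ∀ i, F b i x = F a i x := by
    intro a b x hx i
    obtain ⟨t0, t1⟩ := A.transition a b x ⟨hVA a hx.1, hVA b hx.2⟩ _ rfl
    set g := Complex.exp (2 * Real.pi * Complex.I * A.logTransition a b x)
    have hzg : z b x * g = z a x := by
      have hL := hu a b x hx
      simp only [z, g]
      rw [← Complex.exp_add, Complex.exp_eq_exp_iff_exists_int]
      refine ⟨m a b x, ?_⟩
      linear_combination (2 * Real.pi * Complex.I) * hL
    have hre := congrArg Complex.re hzg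
    have him := congrArg Complex.im hzg
    rw [Complex.mul_re] at hre
    rw [Complex.mul_im] at him
    simp only [F, Fin.sum_univ_two, t0, t1]
    fin_cases i
    · simp [C, ← hre, ← him]
      module
    · simp [C, ← hre, ← him]
      module
  have hpos : ∀ x, IsPositiveFrame (σ.at_ x) (fun i => F x i x) := by
    intro x
    refine ((A.positive_frame x x (A.cover.mem x)).sum_smul_iff (C x x)).2 ?_
    have : (C x x).det = Complex.normSq (z x x) := by
      simp [C, Matrix.det_fin_two, Complex.normSq_apply]
    rw [this]
    exact Complex.normSq_pos.2 (Complex.exp_ne_zero _)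
  have hli : ∀ x, LinearIndependent ℝ (fun i => (F x i x : TangentSpace (𝓡 3) x)) := fun x =>
    (hpos x).linearIndependent.map' (ξ.plane x).subtype (Submodule.ker_subtype _)
  -- The glued frame uses at `x` the local frame with index `x`; on `V.nbhd a` it coincides with the
  -- continuous `F a`.
  refine ⟨fun i x => F x i x, fun i => ?_, hli, fun x =>
    ξ.isPlaneField.span_eq_of_linearIndependent x (hli x) fun i => (F x i x).2⟩
  have hloc : ∀ a, ContinuousFieldOn id (fun x => (F x i x : TangentSpace (𝓡 3) x)) (V.nbhd a) := by
    intro a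
    have h1 : ContinuousFieldOn id (fun x => ∑ j, C a x j i • (A.frame a j x : TangentSpace (𝓡 3) x))
        (V.nbhd a) := by
      refine ContinuousFieldOn.sum_smul continuous_id
        (fun j => (A.continuous_frame a j).mono (hVA a)) fun j => ?_
      have c1 := Complex.continuous_re.comp_continuousOn (hzc a)
      have c2 := Complex.continuous_im.comp_continuousOn (hzc a)
      fin_cases i <;> fin_cases j
      exacts [c1, c2, c2.neg, c1]
    refine ContinuousOn.congr h1 fun x hx => ?_
    exact congrArg (Bundle.TotalSpace.mk x)
      ((congrArg Subtype.val (hF a x x ⟨hx, V.mem x⟩ i)).trans (by simp [F]))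
  intro x _
  exact ((hloc x).continuousAt ((V.isOpen x).mem_nhds (V.mem x))).continuousWithinAt

/-! ### Completing a plane frame to a framing -/

theorem isPositiveFrame_iff_det_pos {ι V : Type*} [Fintype ι] [DecidableEq ι] [AddCommGroup V]
    [Module ℝ V] (b : Basis ι ℝ V) (v : ι → V) :
    IsPositiveFrame b.orientation v ↔ 0 < b.det v := by
  have h : IsPositiveFrame b.orientation b := ⟨b, rfl, rfl⟩
  have hv : v = fun i => ∑ j, b.toMatrix v j i • b j := by
    ext i
    rw [b.sum_toMatrix_smul_self]
  rw [Basis.det_apply, ← h.sum_smul_iff, ← hv]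

/-- The determinant is linear in the third vector, so positivity cuts out an open half-space, or the
empty set. If no basis induces `o`, the set is empty as well. -/
theorem convex_setOf_isPositiveFrame {V : Type*} [AddCommGroup V] [Module ℝ V]
    (o : Orientation ℝ V (Fin 3)) (w₀ w₁ : V) :
    Convex ℝ {v | IsPositiveFrame o ![w₀, w₁, v]} := by
  by_cases ho : ∃ b : Basis (Fin 3) ℝ V, b.orientation = o
  · obtain ⟨b, rfl⟩ := ho
    have : {v | IsPositiveFrame b.orientation ![w₀, w₁, v]} =
        {v | 0 < b.det.toMultilinearMap.toLinearMap ![w₀, w₁, 0] 2 v} := by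
      ext v
      have hv : ![w₀, w₁, v] = Function.update ![w₀, w₁, 0] 2 v := by
        ext i
        fin_cases i <;> simp
      rw [mem_ofPred_eq, isPositiveFrame_iff_det_pos, hv]
      rfl
    rw [this]
    exact convex_halfSpace_gt (LinearMap.isLinear _) 0
  · rintro v ⟨b, -, hb⟩
    exact (ho ⟨b, hb⟩).elim

/-- A frame of a plane field can be completed to a framing. -/
theorem ManifoldOrientation.exists_framing_of_linearIndependent [T2Space M] [CompactSpace M]
    (o : ManifoldOrientation M) {W : Fin 2 → ∀ x, TangentSpace (𝓡 3) x}
    (hW : ∀ i, ContinuousFieldOn id (W i) univ)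
    (hli : ∀ x, LinearIndependent ℝ (fun i => W i x)) :
    ∃ X : Framing o, ∀ i : Fin 2, X.field i.castSucc = W i := by
  -- Local completions are averaged by a partition of unity; convexity keeps the average positive.
  -- Smoothness of order 0 means continuity.
  obtain ⟨s, hs⟩ := exists_contMDiffSection_forall_mem_convex_of_local (I := 𝓡 3) (n := 0)
    (F_fiber := EuclideanSpace ℝ (Fin 3)) (fun x : M => TangentSpace (𝓡 3) x)
    (fun x => {v | IsPositiveFrame (o.at_ x) ![W 0 x, W 1 x, v]})
    (fun x => convex_setOf_isPositiveFrame _ _ _) (fun x₀ => by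
      obtain ⟨U, hU, X, hX, hpos⟩ := o.exists_frame x₀
      have hex : ∀ i x, ∃ c : Fin 3 → ℝ, x ∈ U → W i x = ∑ j, c j • X j x := by
        intro i x
        by_cases hx : x ∈ U
        · obtain ⟨c, hc⟩ := (hpos x hx).exists_eq_sum (W i x)
          exact ⟨c, fun _ => hc⟩
        · exact ⟨0, fun h => (hx h).elim⟩
      choose c hc using hex
      have hcc : ∀ i, ContinuousOn (c i) U := fun i =>
        ContinuousFieldOn.continuousOn_coeff continuous_id hX
          (fun x hx => (hpos x hx).linearIndependent)
          (ContinuousOn.congr ((hW i).mono (subset_univ U)) fun x hx =>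
            congrArg (Bundle.TotalSpace.mk x) (hc i x hx).symm)
      -- The local third field is the cross product of the coordinates of `W 0` and `W 1` in a local
      -- positive frame.
      refine ⟨U, hU, fun x => ∑ j, crossProduct (c 0 x) (c 1 x) j • X j x, ?_, fun x hx => ?_⟩
      · refine contMDiffOn_zero_iff.2 ?_
        exact ContinuousFieldOn.sum_smul continuous_id hX fun j =>
          (continuous_apply j).comp_continuousOn ((hcc 0).crossProduct (hcc 1))
      · have hcl : LinearIndependent ℝ (fun i => c i x) := by
          refine LinearIndependent.of_comp (Fintype.linearCombination ℝ fun j => X j x) ?_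
          convert hli x using 1
          exact funext fun i => (hc i x hx).symm
        have := ((hpos x hx).sum_smul_iff _).2 (det_crossFrame_pos hcl)
        have hfun : (fun i => ∑ j, crossFrame (c 0 x) (c 1 x) j i • X j x) =
            ![W 0 x, W 1 x, ∑ j, crossProduct (c 0 x) (c 1 x) j • X j x] := by
          funext i
          fin_cases i
          · exact (hc 0 x hx).symm
          · exact (hc 1 x hx).symm
          · rfl
        rw [hfun] at this
        exact this)
  refine ⟨⟨![W 0, W 1, s], ⟨fun i => ?_, fun x => ?_⟩⟩, fun i => ?_⟩
  · fin_cases i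
    · exact hW 0
    · exact hW 1
    · exact s.contMDiff.continuous.continuousOn
  · have : (fun i => (![W 0, W 1, s] : Fin 3 → ∀ x, TangentSpace (𝓡 3) x) i x) =
        ![W 0 x, W 1 x, s x] := by
      ext i
      fin_cases i <;> rfl
    simp only [this]
    exact hs x
  · fin_cases i <;> rfl

theorem PlaneField.ext {ξ η : PlaneField M} (h : ξ.plane = η.plane) : ξ = η := by
  cases ξ; cases η; cases h; rfl

theorem PlaneField.IsOrientableWithZeroChernClass.exists_framing [T2Space M] [CompactSpace M]
    (o : ManifoldOrientation M) {ξ : PlaneField M} (h : ξ.IsOrientableWithZeroChernClass) :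
    ∃ X : Framing o, X.planeField = ξ := by
  obtain ⟨W, hW, hli, hspan⟩ := PlaneField.exists_frame_of_zeroChernClass h
  obtain ⟨X, hX⟩ := o.exists_framing_of_linearIndependent hW hli
  refine ⟨X, PlaneField.ext (funext fun x => ?_)⟩
  rw [← hspan x]
  change Submodule.span ℝ (range fun i : Fin 2 => X.field i.castSucc x) = _
  simp only [hX]

end Manifold

/-! ### The bijection on homotopy classes -/

theorem mainTheorem8 {M : Type u} [TopologicalSpace M] [T2Space M] [CompactSpace M]
    [ChartedSpace (EuclideanSpace ℝ (Fin 3)) M] [IsManifold (𝓡 3) ∞ M]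
    (hM : HasRationalHomologyOfThreeSphere M) (o : ManifoldOrientation M) :
    ∃ Φ : FramingClass o ≃ ZeroChernPlaneFieldClass M, ∀ X : Framing o,
      ∃ h : X.planeField.IsOrientableWithZeroChernClass,
        Φ X.homotopyClass = X.planeField.homotopyClass h := by
  have : LocallyPathConnectedSpace M :=
    ChartedSpace.locallyPathConnectedSpace (EuclideanSpace ℝ (Fin 3)) M
  have hM1 : Subsingleton (rationalHomology M 1) := (hM 1).2 ⟨one_ne_zero, by norm_num⟩
  let F : FramingClass o → ZeroChernPlaneFieldClass M := Quotient.lift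
    (fun X : Framing o => X.planeField.homotopyClass X.isOrientableWithZeroChernClass)
    fun X Y h => Quotient.sound (s := PlaneField.homotopySetoid M) (Framing.Homotopic.planeField h)
  have hF : Function.Bijective F := by
    constructor
    · rintro ⟨X⟩ ⟨Y⟩ hXY
      have h : X.planeField.Homotopic Y.planeField :=
        Quotient.exact (s := PlaneField.homotopySetoid M) hXY
      -- First `X` is moved along the homotopy of plane fields until it spans the planes of `Y`;
      -- then only the frame inside a fixed plane field has to be compared.
      obtain ⟨X', hX', hX'Y⟩ := X.exists_homotopic_planeField_eq h
      exact Quotient.sound (s := Framing.homotopySetoid o)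
        (hX'.trans (Framing.homotopic_of_planeField_eq hM1 hX'Y.symm))
    · rintro ⟨ξ, hξ⟩
      obtain ⟨X, rfl⟩ := hξ.exists_framing o
      exact ⟨X.homotopyClass, rfl⟩
  exact ⟨Equiv.ofBijective F hF, fun X => ⟨X.isOrientableWithZeroChernClass, rfl⟩⟩
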